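/- For a partition $\lambda\vdash n$ let $\chi^\lambda$ be the corresponding irreducible complex character of $S_n$ and $f^\lambda=\deg\chi^\lambda$ the number of standard Young tableaux of shape $\lambda$. For integers $k,\ell,n\ge 0$ let $H(k,\ell;n)=\{\lambda\vdash n : \lambda_{k+1}\le \ell\}$ and put $$\chi(k,\ell;n)=\sum_{\lambda\in H(k,\ell;n)}\chi^\lambda,\qquad S(k,\ell;n)=\sum_{\lambda\in H(k,\ell;n)}f^\lambda .$$ Let $\Psi(n)=\sum_{k=0}^{\lfloor n/2\rfloor}\chi^{(k,k,1^{n-2k})}$ and $a(n)=\deg\Psi(n)$ (the "Motzkin-sums" character and number), where the term $k=0$ is $\chi^{\emptyset}$ if $n=0$ and is $0$ if $n\ge 1$, since $(0,0,1^n)$ is then not a partition. For class functions $\varphi$ on $S_m$ and $\psi$ on $S_k$ let $\varphi\hat\otimes\psi$ be their outer product, that is, the class function on $S_{m+k}$ induced from $\varphi\otimes\psi$ on $S_m\times S_k$. Then for every integer $n\ge 0$ $$\chi(3,1;n)=\frac12\Bigl[\chi(2,0;n)+\sum_{j=0}^n\Psi(j)\hat\otimes\chi^{(n-j)}\Bigr].$$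 Moreover $\deg\chi(3,1;n)=S(3,1;n)$ and $$S(3,1;n)=\frac12\Bigl[\binom{n}{\lfloor n/2\rfloor}+\sum_{j=0}^n a(j)\binom nj\Bigr].$$ -/

import Mathlib

open scoped MonoidAlgebra

namespace HookChar

/-! ### Partitions, Young diagrams, standard Young tableaux -/

theorem card_cellsOfRowLens (w : List ℕ) :
    (YoungDiagram.cellsOfRowLens w).card = w.sum := by
  induction w with
  | nil => simp [YoungDiagram.cellsOfRowLens]
  | cons a w ih =>
    rw [YoungDiagram.cellsOfRowLens, Finset.card_union_of_disjoint]
    · simp [ih]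
    · rw [Finset.disjoint_left]
      rintro ⟨i, j⟩ h1 h2
      simp only [Finset.mem_product, Finset.mem_singleton] at h1
      simp only [Finset.mem_map] at h2
      obtain ⟨c, -, hc⟩ := h2
      have := congrArg Prod.fst hc
      simp [h1.1] at this

/-- The Young diagram of a partition: its `i`-th row (counted from `0`) consists of the cells
`(i, 0), …, (i, p_i - 1)`, where `p_0 ≥ p_1 ≥ …` are the parts of `p`. -/
def diagram {n : ℕ} (p : n.Partition) : YoungDiagram :=
  YoungDiagram.ofRowLens (p.parts.sort (· ≥ ·)) (p.parts.pairwise_sort (· ≥ ·)).sortedGE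

theorem card_diagram {n : ℕ} (p : n.Partition) : (diagram p).card = n := by
  change (YoungDiagram.cellsOfRowLens _).card = n
  rw [card_cellsOfRowLens, ← Multiset.sum_coe, Multiset.sort_eq, p.parts_sum]

/-- A bijective filling of a Young diagram by `0, …, n - 1`. -/
abbrev Filling (n : ℕ) (μ : YoungDiagram) : Type := {c : ℕ × ℕ // c ∈ μ.cells} ≃ Fin n

/-- A filling is standard if its entries increase along the rows and down the columns. -/
def Filling.IsStandard {n : ℕ} {μ : YoungDiagram} (T : Filling n μ) : Prop :=
  (∀ c d : {c : ℕ × ℕ // c ∈ μ.cells}, c.1.1 = d.1.1 → c.1.2 < d.1.2 → T c < T d) ∧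
  (∀ c d : {c : ℕ × ℕ // c ∈ μ.cells}, c.1.2 = d.1.2 → c.1.1 < d.1.1 → T c < T d)

/-- The number `f^p` of standard Young tableaux of shape `p`. -/
noncomputable def numSYT {n : ℕ} (p : n.Partition) : ℕ :=
  Nat.card {T : Filling n (diagram p) // T.IsStandard}

/-- `H(k, l; n)`: the partitions of `n` in the `(k, l)` hook, that is, those whose
`(k+1)`-st part (row number `k`, counted from `0`) is at most `l`. -/
def hook (k l n : ℕ) : Finset n.Partition :=
  {p : n.Partition | (diagram p).rowLen k ≤ l}

/-- `S(k, l; n)`: the number of standard Young tableaux of size `n` in the `(k, l)` hook. -/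
noncomputable def hookSum (k l n : ℕ) : ℕ :=
  ∑ p ∈ hook k l n, numSYT p

/-! ### The irreducible characters of the symmetric group -/

/-- The row-symmetrizer of a filling: the sum of all permutations that preserve each row. -/
noncomputable def rowSymmetrizer {n : ℕ} {μ : YoungDiagram} (T : Filling n μ) :
    ℂ[Equiv.Perm (Fin n)] :=
  ∑ σ : Equiv.Perm (Fin n) with ∀ i, (T.symm (σ i)).1.1 = (T.symm i).1.1,
    MonoidAlgebra.single σ 1

/-- The column-antisymmetrizer of a filling: the signed sum of all permutations that preserve
each column. -/
noncomputable def colAntisymmetrizer {n : ℕ} {μ : YoungDiagram} (T : Filling n μ) :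
    ℂ[Equiv.Perm (Fin n)] :=
  ∑ σ : Equiv.Perm (Fin n) with ∀ i, (T.symm (σ i)).1.2 = (T.symm i).1.2,
    MonoidAlgebra.single σ ((Equiv.Perm.sign σ : ℤ) : ℂ)

/-- The Specht module, as the left ideal of the group algebra generated by the Young
symmetrizer of the filling `T`. -/
noncomputable def spechtIdeal {n : ℕ} {μ : YoungDiagram} (T : Filling n μ) :
    Ideal ℂ[Equiv.Perm (Fin n)] :=
  Ideal.span {rowSymmetrizer T * colAntisymmetrizer T}

/-- The character of the Specht module of the filling `T`, with `S_n` acting by left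
multiplication. -/
noncomputable def spechtCharacter {n : ℕ} {μ : YoungDiagram} (T : Filling n μ) :
    Equiv.Perm (Fin n) → ℂ :=
  (Representation.ofModule' (k := ℂ) (G := Equiv.Perm (Fin n)) (spechtIdeal T)).character

/-- Some filling of the diagram of `p`. -/
noncomputable def someFilling {n : ℕ} (p : n.Partition) : Filling n (diagram p) :=
  Finset.equivFinOfCardEq (card_diagram p)

/-- The irreducible character `χ^p` of `S_n`. (Different fillings of the same diagram have
conjugate Young symmetrizers, so the choice of the filling does not matter.) -/
noncomputable def irrChar {n : ℕ} (p : n.Partition) : Equiv.Perm (Fin n) → ℂ :=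
  spechtCharacter (someFilling p)

/-- The character `χ(k, l; n)`, the sum of `χ^p` over the partitions `p` of `n` in the `(k, l)`
hook. -/
noncomputable def hookChar (k l n : ℕ) : Equiv.Perm (Fin n) → ℂ :=
  ∑ p ∈ hook k l n, irrChar p

/-- The degree of a character, that is, its value at the identity. -/
def deg {n : ℕ} (f : Equiv.Perm (Fin n) → ℂ) : ℂ := f 1

/-! ### The Motzkin-sums character -/

/-- `χ^w` for a finite sequence `w`: it is `χ^p` if `w` is a weakly decreasing sequence with
sum `n`, `p` being the partition of `n` formed by the nonzero terms of `w`, and `0` if `w` is not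
weakly decreasing or does not have sum `n` (so that it does not denote a partition of `n`). -/
noncomputable def irrCharSeq (n : ℕ) (w : List ℕ) : Equiv.Perm (Fin n) → ℂ :=
  if h : w.SortedGE ∧ (w : Multiset ℕ).sum = n then
    irrChar (Nat.Partition.ofSums n (w : Multiset ℕ) h.2)
  else 0

/-- The Motzkin-sums character `Ψ(n) = ∑_{k = 0}^{⌊n/2⌋} χ^{(k, k, 1^{n-2k})}`. The sequence
`(0, 0, 1^n)` is not a partition for `n ≥ 1`, and is the empty partition for `n = 0`. -/
noncomputable def motzkinChar (n : ℕ) : Equiv.Perm (Fin n) → ℂ :=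
  ∑ k ∈ Finset.range (n / 2 + 1), irrCharSeq n (k :: k :: List.replicate (n - 2 * k) 1)

/-- The Motzkin-sums number `a(n) = deg Ψ(n)`. -/
noncomputable def motzkinSum (n : ℕ) : ℂ := deg (motzkinChar n)

/-! ### The outer product -/

/-- The embedding `S_m × S_k → S_n`, `n = m + k`, in which `S_m` permutes the first `m` points
and `S_k` the last `k` points. -/
def youngEmbedding {m k n : ℕ} (h : m + k = n) :
    Equiv.Perm (Fin m) × Equiv.Perm (Fin k) →* Equiv.Perm (Fin n) :=
  ((finSumFinEquiv.trans (finCongr h)).permCongrHom.toMonoidHom).comp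
    (Equiv.Perm.sumCongrHom (Fin m) (Fin k))

/-- The outer product of a class function `f` on `S_m` and a class function `g` on `S_k`: the
class function on `S_n`, `n = m + k`, that is induced from `f ⊗ g` on `S_m × S_k`, i.e.
`x ↦ (1 / (m! k!)) ∑_y (f ⊗ g)(y⁻¹ x y)`, where `y` runs over the elements of `S_n` with
`y⁻¹ x y ∈ S_m × S_k`. -/
noncomputable def outerProduct {m k n : ℕ} (h : m + k = n)
    (f : Equiv.Perm (Fin m) → ℂ) (g : Equiv.Perm (Fin k) → ℂ) : Equiv.Perm (Fin n) → ℂ :=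
  fun x => (1 / ((m.factorial : ℂ) * (k.factorial : ℂ))) *
    ∑ y : Equiv.Perm (Fin n), ∑ s : Equiv.Perm (Fin m) × Equiv.Perm (Fin k),
      if youngEmbedding h s = y⁻¹ * x * y then f s.1 * g s.2 else 0

end HookChar

/-!
The inner product of class functions `φ`, `ψ` on `S_n` is `(1 / n!) ∑ x, φ x * ψ x`. The irreducible
characters form an orthonormal basis of the class functions (`sum_irrChar_mul_irrChar`,
`IsClassFunction.ext`), so it suffices to compare the inner products of both sides with each `χ^p`.

*Frobenius' formula.* Let `N` be at least the number of rows of `p` and let `δ` be the vector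
`(N - 1, …, 0)`. The value `χ^p(x)` is the coefficient of `X ^ (p + δ)` in the product of the
Vandermonde determinant in `N` variables and the sum of the monomials of the words fixed by `x`
(`spechtCharacter_eq_frobenius`). To see this, expand the determinant: the right side is the
permutation character on words of content `p` plus a combination of those on words of
lexicographically larger content (`sum_mul_frobenius_eq`). The Specht character has inner product
`1` with the first and `0` with the others, by the usual argument with transpositions in the row and
column groups. So the two class functions have inner product `1`; both have norm `1`, hence they are
equal. For the Specht character the norm is computed from the shape of the Young symmetrizer
(`sum_spechtCharacter_mul_self`), for the other function from the dual Pieri rule below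
(`sum_frobenius_mul_frobenius`).

*The dual Pieri rule.* Averaging over a factor `S_k` multiplies the generating polynomial by the
complete homogeneous symmetric polynomial of degree `k`, by Burnside's counting lemma
(`sum_sum_fixed_words`, `sum_frobenius_youngEmbedding`). In the product of an alternating polynomial
with this polynomial all terms cancel except those of horizontal strips
(`IsAlternating.stripSum_add_staircase`). Hence the average of `χ^p` over `S_k` is the sum of the
`χ^v` for which `p / v` is a horizontal strip of size `k` (`sum_irrChar_youngEmbedding`). With
Frobenius reciprocity this is Pieri's rule for outer products with a trivial character
(`sum_outerProduct_one_mul_irrChar`), and for `k = 1` it is the branching rule, which gives the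
degrees by removing the largest entry of a standard tableau (`deg_irrChar`).

*The identity.* The multiplicity of `χ^p` in `∑_j Ψ(j) ⊗̂ χ^(n-j)` is the number of partitions
`v = (k, k, 1, …, 1)` such that `p / v` is a horizontal strip. Interlacing forces `k` to be the second
part of `p` and the fourth part of `p` to be at most `1`; then `v` has as many rows as `p`, or one
less, and both occur as soon as `p` has at least three rows
(`sum_card_isHorizontalStrip_isMotzkin`). Adding the characters with at most two rows makes all the
multiplicities equal to `2`. The degree formula follows, as `χ(2, 0; n)` is the permutation character
on subsets of size `⌊n / 2⌋` (`hookChar_two_zero`).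
-/

namespace HookChar

/-! ### Alternating functions and horizontal strips -/

/-- The exponent vector `(N - 1, …, 1, 0)`. -/
def staircase (N : ℕ) (i : Fin N) : ℕ := N - 1 - i

/-- A function of exponent vectors is alternating if permuting the entries of the argument
multiplies the value by the sign of the permutation, as for the coefficients of an alternating
polynomial. -/
def IsAlternating {N : ℕ} (G : (Fin N → ℕ) → ℂ) : Prop :=
  ∀ (s : Equiv.Perm (Fin N)) (a : Fin N → ℕ), G (a ∘ s) = ((Equiv.Perm.sign s : ℤ) : ℂ) * G a

/-- If `G` is the coefficient function of a polynomial in `N` variables, then `stripSum k G` is that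
of its product with the complete homogeneous symmetric polynomial of degree `k`. -/
noncomputable def stripSum {N : ℕ} (k : ℕ) (G : (Fin N → ℕ) → ℂ) (a : Fin N → ℕ) : ℂ :=
  ∑ c ∈ Finset.Iic a with ∑ i, c i + k = ∑ i, a i, G c

theorem IsAlternating.stripSum {N : ℕ} {G : (Fin N → ℕ) → ℂ} (hG : IsAlternating G) (k : ℕ) :
    IsAlternating (stripSum k G) := by
  intro s a
  unfold HookChar.stripSum
  rw [Finset.mul_sum]
  refine Finset.sum_nbij' (fun c => c ∘ s.symm) (fun c => c ∘ s) ?_ ?_ ?_ ?_ ?_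
  · intro c hc
    simp only [Finset.mem_filter, Finset.mem_Iic, Function.comp_apply] at hc ⊢
    rw [Equiv.sum_comp s.symm c, hc.2, Equiv.sum_comp s a]
    refine ⟨fun i => ?_, rfl⟩
    simpa using hc.1 (s.symm i)
  · intro c hc
    simp only [Finset.mem_filter, Finset.mem_Iic, Function.comp_apply] at hc ⊢
    rw [Equiv.sum_comp s c, hc.2, Equiv.sum_comp s a]
    exact ⟨fun i => hc.1 (s i), rfl⟩
  · intro c _
    ext i; simp
  · intro c _
    ext i; simp
  · intro c _
    rw [← hG s]
    congr 1
    ext i; simp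

/-- An alternating function sums to zero over a set stable under exchanging two entries. -/
theorem IsAlternating.sum_eq_zero_of_swap {N : ℕ} {G : (Fin N → ℕ) → ℂ} (hG : IsAlternating G)
    {i j : Fin N} (hij : i ≠ j) (S : Finset (Fin N → ℕ))
    (hS : ∀ c ∈ S, c ∘ Equiv.swap i j ∈ S) : ∑ c ∈ S, G c = 0 := by
  have h : ∑ c ∈ S, G c = ∑ c ∈ S, -G c := by
    refine Finset.sum_nbij' (fun c => c ∘ Equiv.swap i j) (fun c => c ∘ Equiv.swap i j) hS hS
      ?_ ?_ ?_
    · intro c _; ext x; simp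
    · intro c _; ext x; simp
    · intro c _
      rw [hG, Equiv.Perm.sign_swap hij]; simp
  rw [Finset.sum_neg_distrib] at h
  exact self_eq_neg.1 h

/-- Terms violating the interlacing condition cancel: at the first index `i` with `c i ≤ a (i + 1)`
one exchanges `c i` and `c (i + 1)`. -/
theorem IsAlternating.stripSum_of_strictAnti {N : ℕ} {G : (Fin N → ℕ) → ℂ} (hG : IsAlternating G)
    (k : ℕ) {a : Fin N → ℕ} (ha : StrictAnti a) :
    HookChar.stripSum k G a =
      ∑ c ∈ Finset.Iic a with ∑ i, c i + k = ∑ i, a i ∧ ∀ i j, i < j → a j < c i, G c := by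
  have key : ∀ m : ℕ, HookChar.stripSum k G a =
      ∑ c ∈ Finset.Iic a with ∑ i, c i + k = ∑ i, a i ∧
        ∀ i j : Fin N, j.val = i.val + 1 → i.val < m → a j < c i, G c := by
    intro m
    induction m with
    | zero => simp [HookChar.stripSum]
    | succ m ih =>
      rw [ih]
      by_cases hm : m + 1 < N
      · rw [← Finset.sum_filter_not_add_sum_filter _
          (fun c => a ⟨m + 1, hm⟩ < c ⟨m, by omega⟩)]
        rw [hG.sum_eq_zero_of_swap (i := ⟨m, by omega⟩) (j := ⟨m + 1, hm⟩) (by simp), zero_add,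
          Finset.filter_filter]
        · congr 1
          ext c
          simp only [Finset.mem_filter]
          constructor
          · rintro ⟨h1, ⟨h2, h3⟩, h4⟩
            refine ⟨h1, h2, fun i j hj hi => ?_⟩
            rcases Nat.lt_succ_iff_lt_or_eq.1 hi with h | h
            · exact h3 i j hj h
            · have hi' : i = ⟨m, by omega⟩ := Fin.ext h
              have hj' : j = ⟨m + 1, hm⟩ := Fin.ext (by simp [hj, h])
              rw [hi', hj']; exact h4
          · rintro ⟨h1, h2, h3⟩
            exact ⟨h1, ⟨h2, fun i j hj hi => h3 i j hj (by omega)⟩, h3 _ _ rfl (by simp)⟩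
        · intro c hc
          simp only [Finset.mem_filter, Finset.mem_Iic, not_lt] at hc ⊢
          obtain ⟨⟨h1, h2, h3⟩, h4⟩ := hc
          have hle : a ⟨m + 1, hm⟩ ≤ a ⟨m, by omega⟩ := ha.antitone (by simp)
          refine ⟨⟨fun i => ?_, ?_, fun i j hj hi => ?_⟩, ?_⟩
          · simp only [Function.comp_apply]
            rcases eq_or_ne i ⟨m, by omega⟩ with rfl | hi1
            · rw [Equiv.swap_apply_left]; exact (h1 _).trans hle
            rcases eq_or_ne i ⟨m + 1, by omega⟩ with rfl | hi2
            · rw [Equiv.swap_apply_right]; exact h4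
            · rw [Equiv.swap_apply_of_ne_of_ne hi1 hi2]; exact h1 i
          · rw [← h2]; congr 1; exact Equiv.sum_comp (Equiv.swap _ _) c
          · simp only [Function.comp_apply]
            rw [Equiv.swap_apply_of_ne_of_ne]
            · exact h3 i j hj hi
            · exact fun h => by simp [h] at hi
            · exact fun h => by simp [h] at hi
          · simp only [Function.comp_apply]
            rw [Equiv.swap_apply_left]; exact h1 _
      · congr 1
        ext c
        simp only [Finset.mem_filter]
        refine and_congr_right fun _ => and_congr_right fun _ => ?_
        constructor
        · intro h i j hj _
          have := j.isLt
          exact h i j hj (by omega)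
        · intro h i j hj _
          exact h i j hj (by omega)
  rw [key N]
  congr 1
  ext c
  simp only [Finset.mem_filter]
  refine and_congr_right fun _ => and_congr_right fun _ => ?_
  constructor
  · intro h i j hij
    have hj := j.isLt
    have hij' : i.val < j.val := hij
    exact (ha.antitone (show (⟨i.val + 1, by omega⟩ : Fin N) ≤ j from
      Fin.le_def.2 (by simp only []; omega))).trans_lt (h i ⟨i.val + 1, by omega⟩ rfl i.isLt)
  · intro h i j hj _
    exact h i j (Fin.lt_def.2 (by omega))

/-- Dual Pieri rule: in terms of `l` and `v`, the interlacing condition says that `l / v` is a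
horizontal strip. -/
theorem IsAlternating.stripSum_add_staircase {N : ℕ} {G : (Fin N → ℕ) → ℂ} (hG : IsAlternating G)
    (k : ℕ) {l : Fin N → ℕ} (hl : Antitone l) :
    HookChar.stripSum k G (l + staircase N) =
      ∑ v ∈ Finset.Iic l with (∀ i j, i < j → l j ≤ v i) ∧ ∑ i, v i + k = ∑ i, l i,
        G (v + staircase N) := by
  have hanti : StrictAnti (l + staircase N) := by
    intro i j hij
    have h1 := hl hij.le
    have hij' : i.val < j.val := hij
    have := j.isLt
    simp only [Pi.add_apply, staircase]; omega
  rw [hG.stripSum_of_strictAnti k hanti]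
  symm
  refine Finset.sum_nbij' (fun v => v + staircase N) (fun c => c - staircase N) ?_ ?_ ?_ ?_ ?_
  · intro v hv
    simp only [Finset.mem_filter, Finset.mem_Iic] at hv ⊢
    obtain ⟨h1, h2, h3⟩ := hv
    refine ⟨by gcongr, ?_, fun i j hij => ?_⟩
    · simp only [Pi.add_apply, Finset.sum_add_distrib]; omega
    · have h4 := h2 i j hij
      have hij' : i.val < j.val := hij
      have := j.isLt
      simp only [Pi.add_apply, staircase]; omega
  · intro c hc
    simp only [Finset.mem_filter, Finset.mem_Iic] at hc ⊢
    obtain ⟨h1, h2, h3⟩ := hc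
    have hge : staircase N ≤ c := by
      intro i
      by_cases h : i.val + 1 < N
      · have := h3 i ⟨i.val + 1, h⟩ (Fin.lt_def.2 (by simp))
        simp only [Pi.add_apply, staircase] at this ⊢; omega
      · simp only [staircase]; omega
    refine ⟨fun i => ?_, fun i j hij => ?_, ?_⟩
    · have := h1 i
      simp only [Pi.add_apply, Pi.sub_apply] at this ⊢; omega
    · have hij' : i.val < j.val := hij
      have hj := j.isLt
      have h5 := h3 i ⟨i.val + 1, by omega⟩ (Fin.lt_def.2 (by simp))
      have h6 : l j ≤ l ⟨i.val + 1, by omega⟩ := hl (Fin.le_def.2 (by simp only []; omega))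
      simp only [Pi.add_apply, Pi.sub_apply, staircase] at h5 ⊢; omega
    · have : ∑ i, c i = ∑ i, (c - staircase N) i + ∑ i, staircase N i := by
        rw [← Finset.sum_add_distrib]
        exact Finset.sum_congr rfl fun i _ => (Nat.sub_add_cancel (hge i)).symm
      simp only [Pi.add_apply, Finset.sum_add_distrib] at h2
      omega
  · intro v _; ext i; simp
  · intro c hc
    simp only [Finset.mem_filter, Finset.mem_Iic] at hc
    obtain ⟨h1, h2, h3⟩ := hc
    ext i
    simp only [Pi.add_apply, Pi.sub_apply]
    apply Nat.sub_add_cancel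
    by_cases h : i.val + 1 < N
    · have := h3 i ⟨i.val + 1, h⟩ (Fin.lt_def.2 (by simp))
      simp only [Pi.add_apply, staircase] at this ⊢; omega
    · simp only [staircase]; omega
  · intro v _; rfl

/-! ### Words fixed by permutations -/

section Words

variable {n m k N : ℕ} {ι : Type*} [DecidableEq ι]

/-- The content of a word `f` of length `n`: the number of occurrences of each letter. -/
def content (f : Fin n → ι) (i : ι) : ℕ := Finset.card {x | f x = i}

theorem content_comp_perm (f : Fin n → ι) (s : Equiv.Perm (Fin n)) :
    content (f ∘ s) = content f := by
  funext i
  unfold content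
  refine Finset.card_bij (fun x _ => s x) ?_ ?_ ?_
  · intro x hx; simpa using hx
  · intro x _ y _ h; exact s.injective h
  · intro y hy; exact ⟨s.symm y, by simpa using hy, by simp⟩

theorem content_perm_comp (s : Equiv.Perm ι) (f : Fin n → ι) :
    content (s ∘ f) = content f ∘ s.symm := by
  funext i
  simp [content, Equiv.eq_symm_apply]

theorem sum_content [Fintype ι] (f : Fin n → ι) : ∑ i, content f i = n := by
  have := Finset.card_eq_sum_card_fiberwise (f := f) (s := Finset.univ) (t := Finset.univ)
    (fun _ _ => by simp)
  simpa [content] using this.symm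

theorem exists_content_eq [Fintype ι] (α : ι → ℕ) (hα : ∑ i, α i = n) :
    ∃ f : Fin n → ι, content f = α := by
  have e : Fin n ≃ Σ i, Fin (α i) := Fintype.equivOfCardEq (by simp [hα])
  refine ⟨fun x => (e x).1, ?_⟩
  funext i
  unfold content
  rw [← Fintype.card_subtype, ← Fintype.card_fin (α i)]
  refine Fintype.card_congr ?_
  exact (e.subtypeEquiv (q := fun y => y.1 = i) (fun _ => Iff.rfl)).trans
    (Equiv.sigmaSubtype i)

theorem exists_perm_of_content_eq {f g : Fin n → ι} (h : content f = content g) :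
    ∃ s : Equiv.Perm (Fin n), g = f ∘ s := by
  have e : ∀ i, {x // g x = i} ≃ {x // f x = i} := fun i =>
    Fintype.equivOfCardEq (by
      rw [Fintype.card_subtype, Fintype.card_subtype]; exact (congrFun h i).symm)
  refine ⟨(Equiv.sigmaFiberEquiv g).symm.trans
    ((Equiv.sigmaCongrRight e).trans (Equiv.sigmaFiberEquiv f)), ?_⟩
  funext x
  exact ((e (g x)) ⟨x, rfl⟩).2.symm

/-- The orbits of the symmetric group on words are the sets of words of a given content, so that
Burnside's counting lemma gives the average number of fixed words of each content. -/
theorem sum_sum_fixed_words [Fintype ι] (W : (ι → ℕ) → ℂ) :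
    ∑ x : Equiv.Perm (Fin n), ∑ f : Fin n → ι with f ∘ x = f, W (content f) =
      (n.factorial : ℂ) * ∑ α ∈ Finset.piAntidiag Finset.univ n, W α := by
  have hswap : ∑ x : Equiv.Perm (Fin n), ∑ f : Fin n → ι with f ∘ x = f, W (content f) =
      ∑ f : Fin n → ι, ∑ x ∈ {x : Equiv.Perm (Fin n) | f ∘ x = f}, W (content f) := by
    simp only [Finset.sum_filter]
    exact Finset.sum_comm
  rw [hswap, ← Finset.sum_fiberwise_of_maps_to (s := Finset.univ)
    (t := Finset.piAntidiag Finset.univ n) (g := content) (by simp [sum_content]), Finset.mul_sum]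
  refine Finset.sum_congr rfl fun α hα => ?_
  obtain ⟨f₀, hf₀⟩ := exists_content_eq (n := n) α (by simpa using hα)
  have hstab : ∀ f ∈ ({f | content f = α} : Finset (Fin n → ι)),
      ∑ x ∈ {x : Equiv.Perm (Fin n) | f ∘ x = f}, W (content f) =
        (Finset.card {x : Equiv.Perm (Fin n) | f₀ ∘ x = f} : ℂ) * W α := by
    intro f hf
    obtain ⟨s, rfl⟩ := exists_perm_of_content_eq
      (hf₀.trans (by simpa using hf : content f = α).symm)
    rw [content_comp_perm, hf₀, Finset.sum_const, nsmul_eq_mul]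
    congr 2
    refine Finset.card_bij (fun x _ => s * x) ?_ ?_ ?_
    · intro x hx
      simpa [Function.comp_assoc] using hx
    · intro x _ y _ h; exact mul_left_cancel h
    · intro y hy
      refine ⟨s⁻¹ * y, ?_, by simp⟩
      simp only [Finset.mem_filter, Finset.mem_univ, true_and] at hy ⊢
      funext z; simpa using congrFun hy z
  rw [Finset.sum_congr rfl hstab, ← Finset.sum_mul]
  congr 1
  have h := Finset.card_eq_sum_card_fiberwise (f := fun x : Equiv.Perm (Fin n) => f₀ ∘ x)
    (s := Finset.univ) (t := {f | content f = α}) (by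
      intro x _
      simp [content_comp_perm, hf₀])
  rw [Finset.card_univ, Fintype.card_perm, Fintype.card_fin] at h
  rw [h]; push_cast; rfl

theorem sum_fixed_words_youngEmbedding [Fintype ι] (h : m + k = n)
    (s : Equiv.Perm (Fin m) × Equiv.Perm (Fin k)) (W : (ι → ℕ) → ℂ) :
    ∑ f : Fin n → ι with f ∘ youngEmbedding h s = f, W (content f) =
      ∑ f : Fin m → ι with f ∘ s.1 = f, ∑ g : Fin k → ι with g ∘ s.2 = g,
        W (content f + content g) := by
  subst h
  rw [← Finset.sum_product']
  refine Finset.sum_bij' (fun f _ => (fun i => f (Fin.castAdd k i), fun i => f (Fin.natAdd m i)))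
    (fun p _ => Fin.append p.1 p.2) ?_ ?_ ?_ ?_ ?_
  · intro f hf
    simp only [Finset.mem_filter, Finset.mem_univ, true_and, Finset.mem_product] at hf ⊢
    constructor
    · funext i
      have := congrFun hf (Fin.castAdd k i)
      simpa [youngEmbedding, Equiv.permCongr_apply] using this
    · funext i
      have := congrFun hf (Fin.natAdd m i)
      simpa [youngEmbedding, Equiv.permCongr_apply] using this
  · intro p hp
    simp only [Finset.mem_filter, Finset.mem_univ, true_and, Finset.mem_product] at hp ⊢
    funext i
    refine Fin.addCases (fun i => ?_) (fun i => ?_) i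
    · simpa [youngEmbedding, Equiv.permCongr_apply] using congrFun hp.1 i
    · simpa [youngEmbedding, Equiv.permCongr_apply] using congrFun hp.2 i
  · intro f _
    funext i
    refine Fin.addCases (fun i => ?_) (fun i => ?_) i <;> simp
  · intro p _
    simp
  · intro f _
    congr 1
    funext i
    simp only [content, Finset.card_filter, Pi.add_apply]
    rw [Fin.sum_univ_add]

end Words

/-! ### The Frobenius formula -/

/-- The coefficient of `X ^ a` in the product of `X ^ c` and the Vandermonde determinant
`∑_w sign w • X ^ (w δ)`. -/
def vandermondeCoeff {N : ℕ} (c a : Fin N → ℕ) : ℂ :=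
  ∑ w : Equiv.Perm (Fin N), if c + staircase N ∘ w = a then ((Equiv.Perm.sign w : ℤ) : ℂ) else 0

/-- The coefficient of `X ^ a` in the product of the Vandermonde determinant in `N` variables and
the power sum symmetric polynomial of the cycle type of `x`, the latter being written as the sum of
the monomials of the words fixed by `x`. -/
def frobenius {n : ℕ} (N : ℕ) (a : Fin N → ℕ) (x : Equiv.Perm (Fin n)) : ℂ :=
  ∑ f : Fin n → Fin N with f ∘ x = f, vandermondeCoeff (content f) a

theorem vandermondeCoeff_comp {N : ℕ} (c a : Fin N → ℕ) (s : Equiv.Perm (Fin N)) :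
    vandermondeCoeff (c ∘ s) (a ∘ s) = ((Equiv.Perm.sign s : ℤ) : ℂ) * vandermondeCoeff c a := by
  unfold vandermondeCoeff
  rw [Finset.mul_sum]
  refine Fintype.sum_equiv (Equiv.mulRight s⁻¹) _ _ fun w => ?_
  have h : c ∘ s + staircase N ∘ w = a ∘ s ↔
      c + staircase N ∘ ((Equiv.mulRight s⁻¹) w : Equiv.Perm (Fin N)) = a := by
    constructor
    · intro h; funext i
      simpa using congrFun h (s.symm i)
    · intro h; funext i
      simpa using congrFun h (s i)
  simp only [h, Equiv.coe_mulRight, Equiv.Perm.sign_mul, Equiv.Perm.sign_inv]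
  split_ifs
  · rcases Int.units_eq_one_or (Equiv.Perm.sign s) with h | h <;> simp [h]
  · simp

theorem isAlternating_frobenius {n N : ℕ} (x : Equiv.Perm (Fin n)) :
    IsAlternating fun a => frobenius N a x := by
  intro s a
  simp only [frobenius]
  rw [Finset.mul_sum]
  refine Finset.sum_nbij' (fun f => s ∘ f) (fun f => s.symm ∘ f) ?_ ?_ ?_ ?_ ?_
  · intro f hf
    simp only [Finset.mem_filter, Finset.mem_univ, true_and] at hf ⊢
    rw [Function.comp_assoc, hf]
  · intro f hf
    simp only [Finset.mem_filter, Finset.mem_univ, true_and] at hf ⊢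
    rw [Function.comp_assoc, hf]
  · intro f _; funext i; simp
  · intro f _; funext i; simp
  · intro f _
    rw [← vandermondeCoeff_comp, content_perm_comp]
    congr 1
    funext i; simp

open scoped Classical in
theorem vandermondeCoeff_add {N : ℕ} (c b a : Fin N → ℕ) :
    vandermondeCoeff (c + b) a = if b ≤ a then vandermondeCoeff c (a - b) else 0 := by
  unfold vandermondeCoeff
  split_ifs with hb
  · refine Finset.sum_congr rfl fun w _ => ?_
    congr 1
    rw [eq_iff_iff, funext_iff, funext_iff]
    refine forall_congr' fun i => ?_
    have : b i ≤ a i := hb i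
    simp only [Pi.add_apply, Pi.sub_apply]
    omega
  · refine Finset.sum_eq_zero fun w _ => if_neg fun h => hb ?_
    rw [← h]
    intro i
    exact (Nat.le_add_left _ _).trans (Nat.le_add_right _ _)

open scoped Classical in
theorem sum_piAntidiag_ite_le {N : ℕ} (k : ℕ) (a : Fin N → ℕ) (G : (Fin N → ℕ) → ℂ) :
    ∑ b ∈ Finset.piAntidiag Finset.univ k, (if b ≤ a then G (a - b) else 0) =
      stripSum k G a := by
  rw [← Finset.sum_filter, stripSum]
  have aux : ∀ b : Fin N → ℕ, b ≤ a → ∑ i, (a - b) i + ∑ i, b i = ∑ i, a i := by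
    intro b hb
    rw [← Finset.sum_add_distrib]
    exact Finset.sum_congr rfl fun i _ => Nat.sub_add_cancel (hb i)
  refine Finset.sum_nbij' (fun b => a - b) (fun c => a - c) ?_ ?_ ?_ ?_ ?_
  · intro b hb
    simp only [Finset.mem_filter, Finset.mem_piAntidiag, Finset.mem_Iic] at hb ⊢
    refine ⟨fun i => Nat.sub_le _ _, ?_⟩
    rw [← aux b hb.2, hb.1.1]
  · intro c hc
    simp only [Finset.mem_filter, Finset.mem_piAntidiag, Finset.mem_Iic] at hc ⊢
    refine ⟨⟨?_, fun _ _ => Finset.mem_univ _⟩, fun i => Nat.sub_le _ _⟩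
    have := aux c hc.1
    change ∑ i, (a - c) i = k
    omega
  · intro b hb
    simp only [Finset.mem_filter] at hb
    funext i
    have : b i ≤ a i := hb.2 i
    simp only [Pi.sub_apply]; omega
  · intro c hc
    simp only [Finset.mem_filter, Finset.mem_Iic] at hc
    funext i
    have : c i ≤ a i := hc.1 i
    simp only [Pi.sub_apply]; omega
  · intro b _; rfl

/-- Averaging over the second factor of `S_m × S_k` replaces the power sums of `z` by the complete
homogeneous symmetric polynomial of degree `k`. -/
theorem sum_frobenius_youngEmbedding {m k n N : ℕ} (h : m + k = n) (a : Fin N → ℕ)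
    (y : Equiv.Perm (Fin m)) :
    ∑ z : Equiv.Perm (Fin k), frobenius N a (youngEmbedding h (y, z)) =
      (k.factorial : ℂ) * stripSum k (fun c => frobenius N c y) a := by
  simp only [frobenius]
  rw [Finset.sum_congr rfl fun z _ =>
    sum_fixed_words_youngEmbedding h (y, z) fun c => vandermondeCoeff c a]
  have h2 := sum_sum_fixed_words (n := k) (ι := Fin N) (fun β =>
    ∑ f : Fin m → Fin N with f ∘ y = f, vandermondeCoeff (content f + β) a)
  rw [← sum_piAntidiag_ite_le]
  simp only [vandermondeCoeff_add] at h2 ⊢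
  rw [Finset.sum_congr rfl fun z _ => Finset.sum_comm, h2]
  congr 1
  refine Finset.sum_congr rfl fun b _ => ?_
  split_ifs <;> simp

/-! ### The norm of the Frobenius class functions -/

/-- Coefficients of the product of the Vandermonde determinant in `N` variables with the complete
homogeneous symmetric polynomials of degrees `α 0, …, α (M - 1)`. -/
noncomputable def iteratedStripSum (N : ℕ) (α : ℕ → ℕ) : ℕ → (Fin N → ℕ) → ℂ
  | 0 => vandermondeCoeff 0
  | M + 1 => stripSum (α M) (iteratedStripSum N α M)

/-- The value at `x` of the permutation character on the words of content `α`. -/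
def wordCount {n N : ℕ} (α : Fin N → ℕ) (x : Equiv.Perm (Fin n)) : ℂ :=
  ∑ f : Fin n → Fin N with f ∘ x = f, if content f = α then 1 else 0

theorem isAlternating_iteratedStripSum (N : ℕ) (α : ℕ → ℕ) (M : ℕ) :
    IsAlternating (iteratedStripSum N α M) := by
  induction M with
  | zero =>
    intro s a
    rw [iteratedStripSum, ← vandermondeCoeff_comp]
    rfl
  | succ M ih => exact ih.stripSum _

theorem sum_piFinset_vandermondeCoeff {N : ℕ} (α : ℕ → ℕ) (M : ℕ) (a : Fin N → ℕ) :
    ∑ m ∈ Fintype.piFinset fun j : Fin M => Finset.piAntidiag (Finset.univ : Finset (Fin N)) (α j),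
      vandermondeCoeff (∑ j, m j) a = iteratedStripSum N α M a := by
  classical
  induction M generalizing a with
  | zero => simp [iteratedStripSum, Fintype.piFinset]
  | succ M ih =>
    rw [iteratedStripSum, ← sum_piAntidiag_ite_le]
    have : ∀ b : Fin N → ℕ, (if b ≤ a then iteratedStripSum N α M (a - b) else 0) =
        ∑ m ∈ Fintype.piFinset fun j : Fin M =>
          Finset.piAntidiag (Finset.univ : Finset (Fin N)) (α j),
          vandermondeCoeff (∑ j, m j + b) a := by
      intro b
      simp only [vandermondeCoeff_add, ← ih]
      split_ifs <;> simp
    simp only [this]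
    rw [← Finset.sum_product']
    refine Finset.sum_bij' (fun m _ => (m (Fin.last M), fun j => m j.castSucc))
      (fun p _ => Fin.snoc (α := fun _ => Fin N → ℕ) p.2 p.1) ?_ ?_ ?_ ?_ ?_
    · intro m hm
      rw [Fintype.mem_piFinset] at hm
      rw [Finset.mem_product, Fintype.mem_piFinset]
      exact ⟨by simpa using hm (Fin.last M), fun j => by simpa using hm j.castSucc⟩
    · intro p hp
      rw [Finset.mem_product, Fintype.mem_piFinset] at hp
      rw [Fintype.mem_piFinset]
      intro j
      refine Fin.lastCases ?_ (fun j => ?_) j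
      · simpa using hp.1
      · simpa using hp.2 j
    · intro m _
      exact Fin.snoc_init_self (α := fun _ => Fin N → ℕ) m
    · intro p _
      simp
    · intro m _
      rw [Fin.sum_univ_castSucc]

/-- The inner product with a permutation character on words is a coefficient in a product of complete
homogeneous symmetric polynomials. -/
theorem sum_frobenius_mul_wordCount {n N M : ℕ} (α : ℕ → ℕ) (a : Fin N → ℕ)
    (hα : ∑ j : Fin M, α j = n) :
    ∑ x : Equiv.Perm (Fin n), frobenius N a x * wordCount (fun j : Fin M => α j) x =
      (n.factorial : ℂ) * iteratedStripSum N α M a := by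
  -- A pair of words in `Fin N` and `Fin M` is a word in `Fin N × Fin M`; its content is a matrix
  -- whose marginals are the contents of the two words.
  let W : (Fin N × Fin M → ℕ) → ℂ := fun c =>
    if (fun j => ∑ i, c (i, j)) = (fun j : Fin M => α j) then
      vandermondeCoeff (fun i => ∑ j, c (i, j)) a else 0
  have hpair : ∀ x : Equiv.Perm (Fin n),
      frobenius N a x * wordCount (fun j : Fin M => α j) x =
      ∑ F : Fin n → Fin N × Fin M with F ∘ x = F, W (content F) := by
    intro x
    rw [frobenius, wordCount, Finset.sum_mul_sum, ← Finset.sum_product']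
    symm
    refine Finset.sum_bij' (fun F _ => (fun i => (F i).1, fun i => (F i).2))
      (fun p _ i => (p.1 i, p.2 i)) ?_ ?_ ?_ ?_ ?_
    · intro F hF
      simp only [Finset.mem_filter, Finset.mem_univ, true_and, Finset.mem_product] at hF ⊢
      exact ⟨funext fun i => congrArg Prod.fst (congrFun hF i),
        funext fun i => congrArg Prod.snd (congrFun hF i)⟩
    · intro p hp
      simp only [Finset.mem_filter, Finset.mem_univ, true_and, Finset.mem_product] at hp ⊢
      exact funext fun i => Prod.ext (congrFun hp.1 i) (congrFun hp.2 i)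
    · intro F _; rfl
    · intro p _; rfl
    · intro F _
      have h1 : (fun i => ∑ j, content F (i, j)) = content fun x => (F x).1 := by
        funext i
        simp only [content]
        rw [Finset.card_eq_sum_card_fiberwise (f := fun x => (F x).2) (t := Finset.univ)
          (fun _ _ => by simp)]
        refine Finset.sum_congr rfl fun j _ => ?_
        congr 1; ext x; simp [Prod.ext_iff]
      have h2 : (fun j => ∑ i, content F (i, j)) = content fun x => (F x).2 := by
        funext j
        simp only [content]
        rw [Finset.card_eq_sum_card_fiberwise (f := fun x => (F x).1) (t := Finset.univ)
          (fun _ _ => by simp)]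
        refine Finset.sum_congr rfl fun i _ => ?_
        congr 1; ext x; simp [Prod.ext_iff, and_comm]
      simp only [W, h1, h2, mul_ite, mul_one, mul_zero]
  rw [Finset.sum_congr rfl fun x _ => hpair x, sum_sum_fixed_words W, ← Finset.sum_filter,
    ← sum_piFinset_vandermondeCoeff]
  congr 1
  refine Finset.sum_bij' (fun c _ j i => c (i, j)) (fun m _ p => m p.2 p.1) ?_ ?_ ?_ ?_ ?_
  · intro c hc
    simp only [Finset.mem_filter] at hc
    rw [Fintype.mem_piFinset]
    intro j
    simpa using congrFun hc.2 j
  · intro m hm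
    rw [Fintype.mem_piFinset] at hm
    have hm' : ∀ j, ∑ i, m j i = α j := fun j => by simpa using hm j
    simp only [Finset.mem_filter]
    refine ⟨?_, funext hm'⟩
    simp only [Finset.mem_piAntidiag, Finset.mem_univ, implies_true, and_true]
    rw [Fintype.sum_prod_type_right, ← hα]
    exact Finset.sum_congr rfl fun j _ => hm' j
  · intro c _; rfl
  · intro m _; rfl
  · intro c _
    congr 1
    funext i
    simp

theorem sum_filter_lt_le_of_le {N : ℕ} {u v : Fin N → ℕ} (h : u ≤ v) (s : ℕ) :
    ∑ i : Fin N with i.val < s, u i ≤ ∑ i : Fin N with i.val < s, v i :=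
  Finset.sum_le_sum fun i _ => h i

theorem vandermondeCoeff_zero_staircase (N : ℕ) : vandermondeCoeff 0 (staircase N) = 1 := by
  unfold vandermondeCoeff
  rw [Finset.sum_eq_single 1]
  · simp
  · intro w _ hw
    refine if_neg fun h => hw ?_
    ext i
    have := congrFun h i
    simp only [Pi.add_apply, Pi.zero_apply, zero_add, Function.comp_apply, staircase] at this
    have := (w i).isLt
    simp only [Equiv.Perm.coe_one, id_eq]
    omega
  · simp

/-- A chain of `M` horizontal strips of sizes `α 0, …, α (M - 1)` ending at `l` exists only if `l` has
at most `M` rows and dominates `α`, since the first `s` strips lie in the first `s` rows. -/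
theorem iteratedStripSum_ne_zero {N : ℕ} (α : ℕ → ℕ) (M : ℕ) {l : Fin N → ℕ} (hl : Antitone l)
    (h : iteratedStripSum N α M (l + staircase N) ≠ 0) :
    (∀ i : Fin N, M ≤ i.val → l i = 0) ∧ ∑ i, l i = ∑ j ∈ Finset.range M, α j ∧
      ∀ s ≤ M, ∑ j ∈ Finset.range s, α j ≤ ∑ i : Fin N with i.val < s, l i := by
  induction M generalizing l with
  | zero =>
    obtain ⟨w, -, hw⟩ := Finset.exists_ne_zero_of_sum_ne_zero h
    have hw' : 0 + staircase N ∘ w = l + staircase N := by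
      by_contra h'
      exact hw (if_neg h')
    have hsum : ∑ i, l i = 0 := by
      have := congrArg (fun a : Fin N → ℕ => ∑ i, a i) hw'
      simp only [zero_add, Pi.add_apply, Pi.zero_apply, Finset.sum_add_distrib,
        Function.comp_apply] at this
      rw [Equiv.sum_comp w (staircase N)] at this
      omega
    refine ⟨fun i _ => ?_, by simpa using hsum, fun s hs => ?_⟩
    · exact (Finset.sum_eq_zero_iff.1 hsum) i (Finset.mem_univ i)
    · obtain rfl : s = 0 := by omega
      simp
  | succ M ih =>
    rw [iteratedStripSum, (isAlternating_iteratedStripSum N α M).stripSum_add_staircase _ hl] at h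
    obtain ⟨v, hv, hne⟩ := Finset.exists_ne_zero_of_sum_ne_zero h
    simp only [Finset.mem_filter, Finset.mem_Iic] at hv
    obtain ⟨hvl, hint, hsum⟩ := hv
    have hva : Antitone v := antitone_iff_forall_lt.2 fun i j hij => (hvl j).trans (hint i j hij)
    obtain ⟨h1, h2, h3⟩ := ih hva hne
    have hlz : ∀ i : Fin N, M + 1 ≤ i.val → l i = 0 := by
      intro i hi
      have hlt : (⟨M, by omega⟩ : Fin N) < i := Fin.lt_def.2 (by simpa using hi)
      have h4 := hint _ i hlt
      rw [h1 _ le_rfl] at h4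
      omega
    have hls : ∑ i, l i = ∑ j ∈ Finset.range (M + 1), α j := by
      rw [Finset.sum_range_succ]; omega
    refine ⟨hlz, hls, fun s hs => ?_⟩
    rcases Nat.lt_or_ge M s with h5 | h5
    · obtain rfl : s = M + 1 := by omega
      rw [← hls, Finset.sum_filter_of_ne]
      intro i _ hi
      by_contra h6
      exact hi (hlz i (by omega))
    · exact (h3 s h5).trans (sum_filter_lt_le_of_le hvl s)

/-- The only chain of horizontal strips of sizes `l 0, l 1, …` ending at `l` adds the rows of `l` one
at a time. -/
theorem iteratedStripSum_self {N : ℕ} (α : ℕ → ℕ) (M : ℕ) {l : Fin N → ℕ} (hl : Antitone l)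
    (hM : M ≤ N) (hα : ∀ i : Fin N, i.val < M → α i = l i) (hz : ∀ i : Fin N, M ≤ i.val → l i = 0) :
    iteratedStripSum N α M (l + staircase N) = 1 := by
  induction M generalizing l with
  | zero =>
    obtain rfl : l = 0 := funext fun i => hz i (Nat.zero_le _)
    rw [zero_add, iteratedStripSum, vandermondeCoeff_zero_staircase]
  | succ M ih =>
    rw [iteratedStripSum, (isAlternating_iteratedStripSum N α M).stripSum_add_staircase _ hl]
    set v₀ : Fin N → ℕ := fun i => if i.val < M then l i else 0 with hv₀
    have hM' : M < N := hM
    have hv₀a : Antitone v₀ := by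
      intro i j hij
      have hij' : i.val ≤ j.val := hij
      have := hl hij
      simp only [hv₀]
      split_ifs <;> omega
    have hsum : ∑ i, v₀ i + α M = ∑ i, l i := by
      have : ∀ i : Fin N, l i = v₀ i + if i = ⟨M, hM'⟩ then α M else 0 := by
        intro i
        simp only [hv₀]
        rcases lt_trichotomy i.val M with h | h | h
        · rw [if_pos h, if_neg (fun h' => by simp [h'] at h), add_zero]
        · have hi : i = ⟨M, hM'⟩ := Fin.ext h
          rw [if_neg h.not_lt, if_pos hi, zero_add, ← hα i (by omega), h]
        · rw [if_neg (by omega), if_neg (fun h' => by simp [h'] at h), hz i (by omega)]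
      rw [Finset.sum_congr rfl fun i _ => this i, Finset.sum_add_distrib]
      simp
    have hval : iteratedStripSum N α M (v₀ + staircase N) = 1 :=
      ih hv₀a (by omega) (fun i hi => by simp only [hv₀, if_pos hi]; exact hα i (by omega))
        (fun i hi => if_neg (by omega))
    rw [Finset.sum_eq_single v₀, hval]
    · intro v hv hne
      simp only [Finset.mem_filter, Finset.mem_Iic] at hv
      obtain ⟨hvl, hint, hvs⟩ := hv
      by_contra h
      have hva : Antitone v := antitone_iff_forall_lt.2 fun i j hij => (hvl j).trans (hint i j hij)
      have hvz := (iteratedStripSum_ne_zero α M hva h).1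
      refine hne (funext fun i => ?_)
      have hle : ∀ i ∈ Finset.univ, v i ≤ v₀ i := by
        intro i _
        simp only [hv₀]
        split_ifs with h'
        · exact hvl i
        · exact (hvz i (by omega)).le
      exact (Finset.sum_eq_sum_iff_of_le hle).1 (by omega) i (Finset.mem_univ i)
    · intro h
      refine absurd ?_ h
      simp only [Finset.mem_filter, Finset.mem_Iic]
      refine ⟨fun i => ?_, fun i j hij => ?_, hsum⟩
      · simp only [hv₀]; split_ifs <;> simp
      · have hij' : i.val < j.val := hij
        have := hl hij.le
        simp only [hv₀]
        split_ifs with h'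
        · exact this
        · exact (hz j (by omega)).le

/-- The first index moved by a permutation is moved up. -/
theorem exists_lt_perm_apply {N : ℕ} {w : Equiv.Perm (Fin N)} (hw : w ≠ 1) :
    ∃ s, (∀ j < s, w j = j) ∧ s < w s := by
  classical
  have hex : ∃ s, w s ≠ s := by
    by_contra! h
    exact hw (Equiv.ext h)
  obtain ⟨s, hs, hmin⟩ := WellFounded.has_min (wellFounded_lt (α := Fin N)) {s | w s ≠ s} hex
  have hfix : ∀ j < s, w j = j := fun j hj => by
    by_contra h
    exact hmin j h hj
  refine ⟨s, hfix, lt_of_le_of_ne (not_lt.1 fun h => ?_) (Ne.symm hs)⟩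
  exact hs (w.injective (hfix _ h))

/-- The composition `α` is larger than `l` in the lexicographic order. -/
def LexGT {N : ℕ} (α l : Fin N → ℕ) : Prop := ∃ s, (∀ j < s, α j = l j) ∧ l s < α s

theorem LexGT.trans {N : ℕ} {α β γ : Fin N → ℕ} (h : LexGT α β) (h' : LexGT β γ) : LexGT α γ := by
  obtain ⟨s, hs, hs'⟩ := h
  obtain ⟨t, ht, ht'⟩ := h'
  rcases lt_trichotomy s t with h1 | rfl | h1
  · exact ⟨s, fun j hj => (hs j hj).trans (ht j (hj.trans h1)), by rw [← ht s h1]; exact hs'⟩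
  · exact ⟨s, fun j hj => (hs j hj).trans (ht j hj), ht'.trans hs'⟩
  · exact ⟨t, fun j hj => (hs j (hj.trans h1)).trans (ht j hj), by rw [hs t h1]; exact ht'⟩

theorem lexGT_or_lexGT {N : ℕ} {α β : Fin N → ℕ} (h : α ≠ β) : LexGT α β ∨ LexGT β α := by
  obtain ⟨s, hs, hmin⟩ := WellFounded.has_min (wellFounded_lt (α := Fin N)) {s | α s ≠ β s}
    (Function.ne_iff.1 h)
  have heq : ∀ j < s, α j = β j := fun j hj => by
    by_contra h
    exact hmin j h hj
  rcases lt_or_gt_of_ne hs with h1 | h1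
  · exact Or.inr ⟨s, fun j hj => (heq j hj).symm, h1⟩
  · exact Or.inl ⟨s, heq, h1⟩

theorem LexGT.sum_lt {N : ℕ} {α l : Fin N → ℕ} (h : LexGT α l) :
    ∃ s : ℕ, ∑ i : Fin N with i.val < s, l i < ∑ i : Fin N with i.val < s, α i := by
  obtain ⟨s, hs, hs'⟩ := h
  refine ⟨s + 1, Finset.sum_lt_sum (fun i hi => ?_) ⟨s, by simp, hs'⟩⟩
  simp only [Finset.mem_filter, Finset.mem_univ, true_and] at hi
  rcases Nat.lt_succ_iff_lt_or_eq.1 hi with h | h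
  · exact (hs i h).ge
  · obtain rfl : i = s := Fin.ext h
    exact hs'.le

/-- The Jacobi–Trudi expansion writes `frobenius N (l + δ)` as the permutation character on words of
content `l` plus a combination of permutation characters on words of lexicographically larger
contents. -/
theorem sum_mul_frobenius_eq {n N : ℕ} (φ : Equiv.Perm (Fin n) → ℂ) (l : Fin N → ℕ) (A : ℂ)
    (h0 : ∀ α : Fin N → ℕ, ∑ i, α i = n → LexGT α l → ∑ x, φ x * wordCount α x = 0)
    (h1 : ∑ x, φ x * wordCount l x = A) :
    ∑ x, φ x * frobenius N (l + staircase N) x = A := by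
  have hexp : ∀ x : Equiv.Perm (Fin n), frobenius N (l + staircase N) x =
      ∑ w : Equiv.Perm (Fin N), ((Equiv.Perm.sign w : ℤ) : ℂ) *
        ∑ f : Fin n → Fin N with f ∘ x = f,
          if content f + staircase N ∘ w = l + staircase N then 1 else 0 := by
    intro x
    simp only [frobenius, vandermondeCoeff]
    rw [Finset.sum_comm]
    refine Finset.sum_congr rfl fun w _ => ?_
    rw [Finset.mul_sum]
    simp
  simp only [hexp, Finset.mul_sum]
  rw [Finset.sum_comm, Finset.sum_eq_single 1]
  · rw [← h1]
    refine Finset.sum_congr rfl fun x _ => ?_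
    simp only [wordCount, Equiv.Perm.sign_one, Units.val_one, Int.cast_one, one_mul,
      Equiv.Perm.coe_one, Function.comp_id, add_left_inj, Finset.mul_sum]
  · intro w _ hw
    by_cases hα : ∃ α : Fin N → ℕ, (∑ i, α i = n) ∧ α + staircase N ∘ w = l + staircase N
    · obtain ⟨α, hαn, hα⟩ := hα
      obtain ⟨s, hs1, hs2⟩ := exists_lt_perm_apply hw
      have hpt : ∀ i, α i + staircase N (w i) = l i + staircase N i := congrFun hα
      have hz := h0 α hαn ⟨s, fun j hj => by
        have h2 := hpt j
        rw [hs1 j hj] at h2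
        omega, by
        have h2 := hpt s
        have hs2' : s.val < (w s).val := hs2
        have := (w s).isLt
        simp only [staircase] at h2
        omega⟩
      refine Eq.trans ?_ ((congrArg (((Equiv.Perm.sign w : ℤ) : ℂ) * ·) hz).trans (mul_zero _))
      rw [Finset.mul_sum]
      refine Finset.sum_congr rfl fun x _ => ?_
      rw [wordCount, Finset.mul_sum, Finset.mul_sum]
      refine Finset.sum_congr rfl fun f _ => ?_
      have : content f + staircase N ∘ w = l + staircase N ↔ content f = α := by
        rw [← hα, add_left_inj]
      simp only [this]
      ring
    · refine Finset.sum_eq_zero fun x _ => Finset.sum_eq_zero fun f _ => ?_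
      rw [if_neg fun h => hα ⟨content f, sum_content f, h⟩, mul_zero, mul_zero]
  · simp

/-- The class function `frobenius N (l + δ)` has norm one. -/
theorem sum_frobenius_mul_frobenius {n N : ℕ} {l : Fin N → ℕ} (hl : Antitone l)
    (hn : ∑ i, l i = n) :
    ∑ x : Equiv.Perm (Fin n), frobenius N (l + staircase N) x * frobenius N (l + staircase N) x =
      n.factorial := by
  have hext : ∀ α : Fin N → ℕ, ∃ β : ℕ → ℕ, (fun j : Fin N => β j) = α := fun α =>
    ⟨fun j => if h : j < N then α ⟨j, h⟩ else 0, by funext j; simp⟩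
  refine sum_mul_frobenius_eq _ _ _ ?_ ?_
  · intro α hα hlex
    obtain ⟨s, hs⟩ := hlex.sum_lt
    obtain ⟨β, rfl⟩ := hext α
    rw [sum_frobenius_mul_wordCount β _ hα]
    by_contra h
    have h3 := (iteratedStripSum_ne_zero β N hl (right_ne_zero_of_mul h)).2.2 (min s N)
      (min_le_right _ _)
    have e1 : ∑ i : Fin N with i.val < s, β i = ∑ j ∈ Finset.range (min s N), β j := by
      refine Finset.sum_bij (fun i _ => i.val) ?_ ?_ ?_ ?_
      · intro i hi
        have := i.isLt
        simp only [Finset.mem_filter, Finset.mem_univ, true_and] at hi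
        rw [Finset.mem_range]; omega
      · intro i _ j _ h; exact Fin.ext h
      · intro j hj
        rw [Finset.mem_range] at hj
        exact ⟨⟨j, by omega⟩, by simp; omega, rfl⟩
      · intro i _; rfl
    have e2 : ∑ i : Fin N with i.val < min s N, l i = ∑ i : Fin N with i.val < s, l i := by
      congr 1
      ext i
      have := i.isLt
      simp
    rw [e2, ← e1] at h3
    exact absurd hs (not_lt.2 h3)
  · obtain ⟨β, hβ⟩ := hext l
    have h := sum_frobenius_mul_wordCount (n := n) (N := N) (M := N) β (l + staircase N) (by
      rw [← hn, ← hβ])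
    rw [hβ] at h
    rw [h, iteratedStripSum_self β N hl le_rfl (fun i _ => congrFun hβ i)
      (fun i hi => absurd i.isLt (by omega)), mul_one]

/-! ### Left ideals generated by a multiple of an idempotent -/

section GroupAlgebra

variable {G : Type*} [Group G] [Fintype G]

theorem coeff_mul_eq_sum (x y : ℂ[G]) (g : G) :
    (x * y).coeff g = ∑ u, x.coeff u * y.coeff (u⁻¹ * g) := by
  classical
  rw [MonoidAlgebra.coeff_mul, Finsupp.sum_fintype _ _ (fun _ => by simp)]
  refine Finset.sum_congr rfl fun u _ => ?_
  rw [Finsupp.sum_fintype _ _ (fun _ => by simp), Finset.sum_eq_single (u⁻¹ * g)]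
  · simp
  · intro v _ hv
    rw [if_neg]
    rintro rfl
    simp at hv
  · simp

theorem coeff_single_one_mul (u g : G) (x : ℂ[G]) :
    (MonoidAlgebra.single u 1 * x).coeff g = x.coeff (u⁻¹ * g) := by
  classical
  rw [coeff_mul_eq_sum, Finset.sum_eq_single u]
  · simp
  · intro v _ hv
    rw [MonoidAlgebra.coeff_single, Finsupp.single_eq_of_ne hv, zero_mul]
  · simp

/-- The coefficient at the identity is a trace form. -/
theorem coeff_one_mul_comm (x y : ℂ[G]) : (x * y).coeff 1 = (y * x).coeff 1 := by
  rw [coeff_mul_eq_sum, coeff_mul_eq_sum]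
  refine Fintype.sum_equiv (Equiv.inv G) _ _ fun u => ?_
  simp [mul_comm]

theorem trace_mulLeft_single_comp_mulRight (g : G) (c : ℂ[G]) :
    LinearMap.trace ℂ ℂ[G]
      (LinearMap.mulLeft ℂ (MonoidAlgebra.single g 1) ∘ₗ LinearMap.mulRight ℂ c) =
      ∑ y, c.coeff (y⁻¹ * g⁻¹ * y) := by
  classical
  rw [LinearMap.trace_eq_matrix_trace ℂ (MonoidAlgebra.basis G ℂ), Matrix.trace]
  refine Finset.sum_congr rfl fun y _ => ?_
  rw [Matrix.diag_apply, LinearMap.toMatrix_apply]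
  simp only [LinearMap.comp_apply, LinearMap.mulLeft_apply, LinearMap.mulRight_apply]
  change (MonoidAlgebra.single g 1 * (MonoidAlgebra.basis G ℂ y * c)).coeff y = _
  rw [MonoidAlgebra.basis_apply, coeff_single_one_mul, coeff_single_one_mul, mul_assoc]

instance finite_monoidAlgebra : Module.Finite ℂ ℂ[G] :=
  Module.Finite.of_basis (MonoidAlgebra.basis G ℂ)

/-- If `c * c = h • c` and `h = 0`, then right multiplication by `c` is nilpotent, so its trace
`|G| * c 1` is zero. -/
theorem ne_zero_of_mul_self_eq_smul {c : ℂ[G]} {h : ℂ} (hc : c * c = h • c)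
    (hc1 : c.coeff 1 ≠ 0) : h ≠ 0 := by
  rintro rfl
  have hnil : IsNilpotent (LinearMap.mulRight ℂ c) := by
    refine ⟨2, ?_⟩
    refine LinearMap.ext fun x => ?_
    rw [pow_two]
    simp [mul_assoc, hc]
  have htr := (LinearMap.isNilpotent_trace_of_isNilpotent hnil).eq_zero
  have h1 := trace_mulLeft_single_comp_mulRight 1 c
  have h2 : LinearMap.mulLeft ℂ (MonoidAlgebra.single (1 : G) (1 : ℂ)) = LinearMap.id := by
    refine LinearMap.ext fun x => ?_
    rw [LinearMap.mulLeft_apply, ← MonoidAlgebra.one_def, one_mul, LinearMap.id_apply]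
  rw [h2, LinearMap.id_comp, htr] at h1
  simp only [inv_one, mul_one, inv_mul_cancel, Finset.sum_const, nsmul_eq_mul] at h1
  rcases mul_eq_zero.1 h1.symm with h3 | h3
  · simp at h3
  · exact hc1 h3

/-- Right multiplication by `h⁻¹ • c` is a projection onto the left ideal generated by `c`. -/
theorem character_span_singleton {c : ℂ[G]} {h : ℂ} (hc : c * c = h • c) (hh : h ≠ 0) (g : G) :
    (Representation.ofModule' (k := ℂ) (G := G) (Ideal.span {c} : Ideal ℂ[G])).character g =
      h⁻¹ * ∑ y, c.coeff (y⁻¹ * g⁻¹ * y) := by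
  let I : Ideal ℂ[G] := Ideal.span {c}
  let ι : I →ₗ[ℂ] ℂ[G] := (Submodule.subtype I).restrictScalars ℂ
  let π : ℂ[G] →ₗ[ℂ] I := LinearMap.codRestrict (I.restrictScalars ℂ)
    (LinearMap.mulRight ℂ (h⁻¹ • c)) (fun x => by
      change x * (h⁻¹ • c) ∈ I
      rw [mul_smul_comm, ← smul_mul_assoc]
      exact Ideal.mem_span_singleton'.2 ⟨_, rfl⟩)
  have hfix : ∀ x ∈ I, x * (h⁻¹ • c) = x := by
    intro x hx
    obtain ⟨a, rfl⟩ := Ideal.mem_span_singleton'.1 hx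
    rw [mul_assoc, mul_smul_comm, hc, smul_smul, inv_mul_cancel₀ hh, one_smul]
  have hrep : Representation.ofModule' (k := ℂ) (G := G) I g =
      π ∘ₗ (LinearMap.mulLeft ℂ (MonoidAlgebra.single g 1) ∘ₗ ι) := by
    refine LinearMap.ext fun x => ?_
    apply Subtype.ext
    change _ = (MonoidAlgebra.single g 1 * (x : ℂ[G])) * (h⁻¹ • c)
    rw [hfix _ (I.mul_mem_left _ x.2)]
    simp [Representation.ofModule', MonoidAlgebra.lift_symm_apply]
  rw [Representation.character]
  change LinearMap.trace ℂ I (Representation.ofModule' (k := ℂ) (G := G) I g) = _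
  rw [hrep, LinearMap.trace_comp_comm', LinearMap.comp_assoc]
  have hιπ : ι ∘ₗ π = h⁻¹ • LinearMap.mulRight ℂ c := by
    refine LinearMap.ext fun x => ?_
    change x * (h⁻¹ • c) = h⁻¹ • (x * c)
    rw [mul_smul_comm]
  rw [hιπ, LinearMap.comp_smul, map_smul, trace_mulLeft_single_comp_mulRight, smul_eq_mul]

end GroupAlgebra

/-! ### Row and column groups of a tableau -/

section Tableau

variable {n : ℕ} {μ : YoungDiagram}

/-- The row of the entry `i`. -/
def Filling.row (T : Filling n μ) (i : Fin n) : ℕ := (T.symm i).1.1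

/-- The column of the entry `i`. -/
def Filling.col (T : Filling n μ) (i : Fin n) : ℕ := (T.symm i).1.2

/-- The permutations preserving each row. -/
def Filling.rowGroup (T : Filling n μ) : Subgroup (Equiv.Perm (Fin n)) where
  carrier := {s | ∀ i, T.row (s i) = T.row i}
  mul_mem' {s t} hs ht i := (hs (t i)).trans (ht i)
  one_mem' _ := rfl
  inv_mem' {s} hs i := by simpa using (hs (s⁻¹ i)).symm

/-- The permutations preserving each column. -/
def Filling.colGroup (T : Filling n μ) : Subgroup (Equiv.Perm (Fin n)) where
  carrier := {s | ∀ i, T.col (s i) = T.col i}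
  mul_mem' {s t} hs ht i := (hs (t i)).trans (ht i)
  one_mem' _ := rfl
  inv_mem' {s} hs i := by simpa using (hs (s⁻¹ i)).symm

namespace Filling

variable (T : Filling n μ)

theorem mem_rowGroup {s : Equiv.Perm (Fin n)} : s ∈ T.rowGroup ↔ ∀ i, T.row (s i) = T.row i :=
  Iff.rfl

instance decidableMemRowGroup : DecidablePred (· ∈ T.rowGroup) := fun s =>
  inferInstanceAs (Decidable (∀ i, T.row (s i) = T.row i))

instance decidableMemColGroup : DecidablePred (· ∈ T.colGroup) := fun s =>
  inferInstanceAs (Decidable (∀ i, T.col (s i) = T.col i))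

theorem eq_of_row_eq_of_col_eq {i j : Fin n} (h1 : T.row i = T.row j) (h2 : T.col i = T.col j) :
    i = j :=
  T.symm.injective (Subtype.ext (Prod.ext h1 h2))

theorem row_col_mem (i : Fin n) : (T.row i, T.col i) ∈ μ := (T.symm i).2

theorem exists_row_col {r c : ℕ} (h : (r, c) ∈ μ) : ∃ i, T.row i = r ∧ T.col i = c :=
  ⟨T ⟨(r, c), h⟩, by simp [row], by simp [col]⟩

theorem eq_one_of_mem_of_mem {s : Equiv.Perm (Fin n)} (hr : s ∈ T.rowGroup)
    (hc : s ∈ T.colGroup) : s = 1 :=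
  Equiv.ext fun i => T.eq_of_row_eq_of_col_eq (hr i) (hc i)

theorem swap_mem_rowGroup {i j : Fin n} (h : T.row i = T.row j) :
    Equiv.swap i j ∈ T.rowGroup := by
  intro x
  rw [Equiv.swap_apply_def]
  split_ifs with h1 h2
  · rw [h1, h]
  · rw [h2, h]
  · rfl

theorem swap_mem_colGroup {i j : Fin n} (h : T.col i = T.col j) :
    Equiv.swap i j ∈ T.colGroup := by
  intro x
  rw [Equiv.swap_apply_def]
  split_ifs with h1 h2
  · rw [h1, h]
  · rw [h2, h]
  · rfl

theorem card_row (r : ℕ) : Finset.card {i | T.row i = r} = μ.rowLen r := by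
  rw [← Finset.card_range (μ.rowLen r)]
  refine Finset.card_bij (fun i _ => T.col i) ?_ ?_ ?_
  · intro i hi
    simp only [Finset.mem_filter, Finset.mem_univ, true_and] at hi
    rw [Finset.mem_range, ← YoungDiagram.mem_iff_lt_rowLen, ← hi]
    exact T.row_col_mem i
  · intro i hi j hj h
    simp only [Finset.mem_filter, Finset.mem_univ, true_and] at hi hj
    exact T.eq_of_row_eq_of_col_eq (hi.trans hj.symm) h
  · intro c hc
    rw [Finset.mem_range, ← YoungDiagram.mem_iff_lt_rowLen] at hc
    obtain ⟨i, h1, h2⟩ := T.exists_row_col hc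
    exact ⟨i, by simpa using h1, h2⟩

/-- Pigeonhole principle in one column: if `f` takes distinct values on the column, then at most as
many of its entries have `f < s` as lie in the first `s` rows. -/
theorem card_col_lt_le {f : Fin n → ℕ} (hf : ∀ i j, f i = f j → T.col i = T.col j → i = j)
    (s c : ℕ) :
    Finset.card {i | T.col i = c ∧ f i < s} ≤ Finset.card {i | T.col i = c ∧ T.row i < s} := by
  rcases le_or_gt (μ.colLen c) s with h | h
  · refine Finset.card_le_card fun i hi => ?_
    simp only [Finset.mem_filter, Finset.mem_univ, true_and] at hi ⊢
    refine ⟨hi.1, lt_of_lt_of_le ?_ h⟩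
    rw [← YoungDiagram.mem_iff_lt_colLen, ← hi.1]
    exact T.row_col_mem i
  · refine le_trans (b := s) ?_ ?_
    · rw [← Finset.card_range s]
      refine Finset.card_le_card_of_injOn f (fun i hi => ?_) (fun i hi j hj h' => ?_)
      · simp only [Finset.coe_filter, Finset.mem_univ, true_and, Set.mem_ofPred_eq] at hi
        simpa using hi.2
      · simp only [Finset.coe_filter, Finset.mem_univ, true_and, Set.mem_ofPred_eq] at hi hj
        exact hf i j h' (hi.1.trans hj.1.symm)
    · conv_lhs => rw [← Finset.card_range s]
      refine Finset.card_le_card_of_surjOn T.row fun r hr => ?_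
      simp only [Finset.coe_range, Set.mem_Iio] at hr
      obtain ⟨i, h1, h2⟩ := T.exists_row_col (YoungDiagram.mem_iff_lt_colLen.2 (hr.trans h))
      exact ⟨i, by simp [h1, h2, hr], h1⟩

theorem card_filter_eq_sum_col (p : Fin n → Prop) [DecidablePred p] :
    Finset.card {i | p i} =
      ∑ c ∈ Finset.univ.image T.col, Finset.card {i | T.col i = c ∧ p i} := by
  rw [Finset.card_eq_sum_card_fiberwise (f := T.col) (t := Finset.univ.image T.col)
    (fun i _ => by simp)]
  refine Finset.sum_congr rfl fun c _ => ?_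
  rw [Finset.filter_filter]
  simp only [and_comm]

theorem card_lt_le {f : Fin n → ℕ} (hf : ∀ i j, f i = f j → T.col i = T.col j → i = j) (s : ℕ) :
    Finset.card {i | f i < s} ≤ Finset.card {i | T.row i < s} := by
  rw [T.card_filter_eq_sum_col, T.card_filter_eq_sum_col]
  exact Finset.sum_le_sum fun c _ => T.card_col_lt_le hf s c

/-- If `f` takes distinct values on each column and the same values as the row function, with
multiplicities, then each column takes the values `0, 1, …` up to its length, so that `f` is the row
function permuted by an element of the column group. -/
theorem exists_mem_colGroup {f : Fin n → ℕ} (hf : ∀ i j, f i = f j → T.col i = T.col j → i = j)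
    (hcard : ∀ s, Finset.card {i | f i < s} = Finset.card {i | T.row i < s}) :
    ∃ q ∈ T.colGroup, ∀ i, T.row (q i) = f i := by
  have hmem : ∀ i, (f i, T.col i) ∈ μ := by
    intro i
    rw [YoungDiagram.mem_iff_lt_colLen]
    have h1 := hcard (μ.colLen (T.col i))
    rw [T.card_filter_eq_sum_col, T.card_filter_eq_sum_col] at h1
    have h2 := (Finset.sum_eq_sum_iff_of_le fun c _ =>
      T.card_col_lt_le hf (μ.colLen (T.col i)) c).1 h1 (T.col i) (by simp)
    have h3 : ({j | T.col j = T.col i ∧ T.row j < μ.colLen (T.col i)} : Finset (Fin n)) =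
        ({j | T.col j = T.col i} : Finset (Fin n)) := by
      ext j
      simp only [Finset.mem_filter, Finset.mem_univ, true_and, and_iff_left_iff_imp]
      intro hj
      rw [← YoungDiagram.mem_iff_lt_colLen, ← hj]
      exact T.row_col_mem j
    rw [h3] at h2
    have h4 : ({j | T.col j = T.col i ∧ f j < μ.colLen (T.col i)} : Finset (Fin n)) =
        ({j | T.col j = T.col i} : Finset (Fin n)) :=
      Finset.eq_of_subset_of_card_le (fun j => by simp +contextual) h2.ge
    have h5 : i ∈ ({j | T.col j = T.col i} : Finset (Fin n)) := by simp
    rw [← h4] at h5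
    simpa using h5
  have hinj : Function.Injective fun i => T ⟨(f i, T.col i), hmem i⟩ := by
    intro i j h
    have h' := congrArg Subtype.val (T.injective h)
    exact hf i j (Prod.ext_iff.1 h').1 (Prod.ext_iff.1 h').2
  refine ⟨Equiv.ofBijective _ (Finite.injective_iff_bijective.1 hinj), fun i => ?_, fun i => ?_⟩
  · simp [col]
  · simp [row]

end Filling

/-! ### The Young symmetrizer -/

open MonoidAlgebra (single)

variable (T : Filling n μ)

theorem rowSymmetrizer_eq : rowSymmetrizer T =
    ∑ r : Equiv.Perm (Fin n) with r ∈ T.rowGroup, single r 1 := rfl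

theorem colAntisymmetrizer_eq : colAntisymmetrizer T =
    ∑ q : Equiv.Perm (Fin n) with q ∈ T.colGroup, single q ((Equiv.Perm.sign q : ℤ) : ℂ) := rfl

theorem sign_mul_self (s : Equiv.Perm (Fin n)) :
    ((Equiv.Perm.sign s : ℤ) : ℂ) * ((Equiv.Perm.sign s : ℤ) : ℂ) = 1 := by
  rcases Int.units_eq_one_or (Equiv.Perm.sign s) with h | h <;> simp [h]

theorem rowSymmetrizer_mul_single {r : Equiv.Perm (Fin n)} (hr : r ∈ T.rowGroup) :
    rowSymmetrizer T * single r 1 = rowSymmetrizer T := by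
  rw [rowSymmetrizer_eq, Finset.sum_mul]
  refine Finset.sum_nbij' (fun s => s * r) (fun s => s * r⁻¹) ?_ ?_ ?_ ?_ ?_
  · intro s hs
    simp only [Finset.mem_filter, Finset.mem_univ, true_and] at hs ⊢
    exact T.rowGroup.mul_mem hs hr
  · intro s hs
    simp only [Finset.mem_filter, Finset.mem_univ, true_and] at hs ⊢
    exact T.rowGroup.mul_mem hs (T.rowGroup.inv_mem hr)
  · intro s _; simp
  · intro s _; simp
  · intro s _; simp

theorem single_mul_colAntisymmetrizer {q : Equiv.Perm (Fin n)} (hq : q ∈ T.colGroup) :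
    single q 1 * colAntisymmetrizer T =
      ((Equiv.Perm.sign q : ℤ) : ℂ) • colAntisymmetrizer T := by
  rw [colAntisymmetrizer_eq, Finset.mul_sum, Finset.smul_sum]
  refine Finset.sum_nbij' (fun s => q * s) (fun s => q⁻¹ * s) ?_ ?_ ?_ ?_ ?_
  · intro s hs
    simp only [Finset.mem_filter, Finset.mem_univ, true_and] at hs ⊢
    exact T.colGroup.mul_mem hq hs
  · intro s hs
    simp only [Finset.mem_filter, Finset.mem_univ, true_and] at hs ⊢
    exact T.colGroup.mul_mem (T.colGroup.inv_mem hq) hs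
  · intro s _; simp
  · intro s _; simp
  · intro s _
    rw [MonoidAlgebra.single_mul_single, MonoidAlgebra.smul_single, one_mul, smul_eq_mul,
      Equiv.Perm.sign_mul, Units.val_mul, Int.cast_mul, ← mul_assoc, sign_mul_self, one_mul]

/-- If two entries of one column are sent by `y` into one row, then the corresponding transposition
shows that the product vanishes; otherwise `y` is the product of a row and a column permutation. -/
theorem exists_rowSymmetrizer_mul_single_mul (y : Equiv.Perm (Fin n)) :
    ∃ t : ℂ, rowSymmetrizer T * single y 1 * colAntisymmetrizer T =
      t • (rowSymmetrizer T * colAntisymmetrizer T) := by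
  by_cases hf : ∀ i j, T.row (y i) = T.row (y j) → T.col i = T.col j → i = j
  · obtain ⟨q, hq, hqr⟩ := T.exists_mem_colGroup (f := fun i => T.row (y i)) hf (fun s => by
      refine Finset.card_bij (fun i _ => y i) ?_ ?_ ?_
      · intro i hi; simpa using hi
      · intro i _ j _ h; exact y.injective h
      · intro j hj; exact ⟨y.symm j, by simpa using hj, by simp⟩)
    refine ⟨((Equiv.Perm.sign q : ℤ) : ℂ), ?_⟩
    have hr : y * q⁻¹ ∈ T.rowGroup := by
      intro i
      simpa using (hqr (q⁻¹ i)).symm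
    have hy : single y (1 : ℂ) = single (y * q⁻¹) 1 * single q 1 := by simp
    rw [hy, ← mul_assoc, rowSymmetrizer_mul_single T hr, mul_assoc,
      single_mul_colAntisymmetrizer T hq, mul_smul_comm]
  · push Not at hf
    obtain ⟨i, j, h1, h2, hij⟩ := hf
    refine ⟨0, ?_⟩
    rw [zero_smul]
    have hq := T.swap_mem_colGroup h2
    have hr := T.swap_mem_rowGroup h1
    have h3 : rowSymmetrizer T * single y 1 * colAntisymmetrizer T =
        -(rowSymmetrizer T * single y 1 * colAntisymmetrizer T) := by
      conv_lhs => rw [← rowSymmetrizer_mul_single T hr]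
      rw [mul_assoc (rowSymmetrizer T), MonoidAlgebra.single_mul_single,
        ← Equiv.mul_swap_eq_swap_mul, ← MonoidAlgebra.single_mul_single, mul_assoc, mul_assoc,
        single_mul_colAntisymmetrizer T hq, Equiv.Perm.sign_swap hij]
      simp [mul_assoc]
    have h4 : (2 : ℂ) • (rowSymmetrizer T * single y 1 * colAntisymmetrizer T) = 0 := by
      rw [two_smul]
      exact add_eq_zero_iff_eq_neg.2 h3
    exact (smul_eq_zero.1 h4).resolve_left two_ne_zero

theorem exists_rowSymmetrizer_mul_mul (z : ℂ[Equiv.Perm (Fin n)]) :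
    ∃ t : ℂ, rowSymmetrizer T * z * colAntisymmetrizer T =
      t • (rowSymmetrizer T * colAntisymmetrizer T) := by
  induction z using MonoidAlgebra.induction_linear with
  | zero => exact ⟨0, by simp⟩
  | add x y hx hy =>
    obtain ⟨t, ht⟩ := hx
    obtain ⟨u, hu⟩ := hy
    exact ⟨t + u, by rw [mul_add, add_mul, ht, hu, add_smul]⟩
  | single g r =>
    obtain ⟨t, ht⟩ := exists_rowSymmetrizer_mul_single_mul T g
    refine ⟨r * t, ?_⟩
    have : single g r = r • single g (1 : ℂ) := by simp
    rw [this, mul_smul_comm, smul_mul_assoc, ht, smul_smul]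

/-- The Young symmetrizer of a filling. -/
noncomputable def youngSymmetrizer : ℂ[Equiv.Perm (Fin n)] :=
  rowSymmetrizer T * colAntisymmetrizer T

theorem sum_coeff_youngSymmetrizer_mul (φ : Equiv.Perm (Fin n) → ℂ) :
    ∑ g, (youngSymmetrizer T).coeff g * φ g =
      ∑ r : Equiv.Perm (Fin n) with r ∈ T.rowGroup, ∑ q : Equiv.Perm (Fin n) with q ∈ T.colGroup,
        ((Equiv.Perm.sign q : ℤ) : ℂ) * φ (r * q) := by
  rw [youngSymmetrizer, rowSymmetrizer_eq, colAntisymmetrizer_eq, Finset.sum_mul_sum]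
  simp only [MonoidAlgebra.coeff_sum, MonoidAlgebra.single_mul_single, one_mul,
    MonoidAlgebra.coeff_single, Finsupp.finsetSum_apply, Finset.sum_mul]
  rw [Finset.sum_comm]
  refine Finset.sum_congr rfl fun r _ => ?_
  rw [Finset.sum_comm]
  refine Finset.sum_congr rfl fun q _ => ?_
  rw [Finset.sum_eq_single (r * q)]
  · simp
  · intro g _ hg
    rw [Finsupp.single_eq_of_ne hg, zero_mul]
  · simp

theorem coeff_youngSymmetrizer_one : (youngSymmetrizer T).coeff 1 = 1 := by
  have h := sum_coeff_youngSymmetrizer_mul T fun g => if g = 1 then 1 else 0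
  rw [Finset.sum_eq_single 1 (by intro b _ hb; simp [hb]) (by simp), if_pos rfl, mul_one] at h
  rw [h, Finset.sum_eq_single 1, Finset.sum_eq_single 1]
  · simp
  · intro q _ hq; simp [hq]
  · intro h; exact absurd (by simp) h
  · intro r hr hr1
    refine Finset.sum_eq_zero fun q hq => ?_
    simp only [Finset.mem_filter, Finset.mem_univ, true_and] at hr hq
    rw [if_neg, mul_zero]
    intro h
    refine hr1 (T.eq_one_of_mem_of_mem hr ?_)
    rw [mul_eq_one_iff_eq_inv.1 h]
    exact T.colGroup.inv_mem hq
  · intro h; exact absurd (by simp) h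

theorem exists_youngSymmetrizer_mul_self :
    ∃ h : ℂ, h ≠ 0 ∧ youngSymmetrizer T * youngSymmetrizer T = h • youngSymmetrizer T := by
  obtain ⟨h, hh⟩ := exists_rowSymmetrizer_mul_mul T (colAntisymmetrizer T * rowSymmetrizer T)
  have hc : youngSymmetrizer T * youngSymmetrizer T = h • youngSymmetrizer T := by
    rw [youngSymmetrizer, ← hh]
    simp only [mul_assoc]
  exact ⟨h, ne_zero_of_mul_self_eq_smul hc (by rw [coeff_youngSymmetrizer_one]; exact one_ne_zero),
    hc⟩

end Tableau

/-! ### Specht characters -/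

/-- Class functions on a symmetric group. -/
def IsClassFunction {n : ℕ} (φ : Equiv.Perm (Fin n) → ℂ) : Prop :=
  ∀ x y, φ (y * x * y⁻¹) = φ x

theorem IsClassFunction.apply_eq_of_isConj {n : ℕ} {φ : Equiv.Perm (Fin n) → ℂ}
    (hφ : IsClassFunction φ) {x y : Equiv.Perm (Fin n)} (h : IsConj x y) : φ x = φ y := by
  obtain ⟨c, rfl⟩ := isConj_iff.1 h
  exact (hφ x c).symm

theorem IsClassFunction.apply_inv {n : ℕ} {φ : Equiv.Perm (Fin n) → ℂ}
    (hφ : IsClassFunction φ) (x : Equiv.Perm (Fin n)) : φ x⁻¹ = φ x :=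
  hφ.apply_eq_of_isConj (Equiv.Perm.isConj_iff_cycleType_eq.2 (Equiv.Perm.cycleType_inv x))

theorem isClassFunction_wordCount {n N : ℕ} (α : Fin N → ℕ) :
    IsClassFunction (n := n) (wordCount α) := by
  intro x y
  unfold wordCount
  refine Finset.sum_nbij' (fun f => f ∘ y) (fun f => f ∘ y.symm) ?_ ?_ ?_ ?_ ?_
  · intro f hf
    simp only [Finset.mem_filter, Finset.mem_univ, true_and] at hf ⊢
    funext i
    simpa using congrFun hf (y i)
  · intro f hf
    simp only [Finset.mem_filter, Finset.mem_univ, true_and] at hf ⊢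
    funext i
    simpa using congrFun hf (y.symm i)
  · intro f _; funext i; simp
  · intro f _; funext i; simp
  · intro f _; simp only [content_comp_perm]

section Specht

variable {n : ℕ} {μ : YoungDiagram} (T : Filling n μ)

theorem spechtCharacter_apply {h : ℂ} (hh : h ≠ 0)
    (hc : youngSymmetrizer T * youngSymmetrizer T = h • youngSymmetrizer T)
    (g : Equiv.Perm (Fin n)) :
    spechtCharacter T g = h⁻¹ * ∑ y, (youngSymmetrizer T).coeff (y⁻¹ * g⁻¹ * y) :=
  character_span_singleton hc hh g

theorem isClassFunction_spechtCharacter : IsClassFunction (spechtCharacter T) := by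
  obtain ⟨h, hh, hc⟩ := exists_youngSymmetrizer_mul_self T
  intro x y
  rw [spechtCharacter_apply T hh hc, spechtCharacter_apply T hh hc]
  congr 1
  refine Fintype.sum_equiv (Equiv.mulLeft y⁻¹) _ _ fun z => ?_
  simp [mul_assoc]

theorem sum_spechtCharacter_mul {h : ℂ} (hh : h ≠ 0)
    (hc : youngSymmetrizer T * youngSymmetrizer T = h • youngSymmetrizer T)
    {φ : Equiv.Perm (Fin n) → ℂ} (hφ : IsClassFunction φ) :
    ∑ g, spechtCharacter T g * φ g =
      h⁻¹ * n.factorial * ∑ g, (youngSymmetrizer T).coeff g * φ g := by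
  simp only [spechtCharacter_apply T hh hc, mul_assoc, ← Finset.mul_sum]
  congr 1
  simp only [Finset.sum_mul]
  rw [Finset.sum_comm]
  have : ∀ y : Equiv.Perm (Fin n),
      ∑ g, (youngSymmetrizer T).coeff (y⁻¹ * (g⁻¹ * y)) * φ g =
        ∑ g, (youngSymmetrizer T).coeff g * φ g := by
    intro y
    refine Fintype.sum_equiv ((Equiv.inv _).trans (MulAut.conj y⁻¹).toEquiv) _ _ fun g => ?_
    have h1 : φ (y⁻¹ * g⁻¹ * y) = φ g := by
      have := hφ g⁻¹ y⁻¹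
      rw [inv_inv] at this
      rw [this, hφ.apply_inv]
    simp [← h1, mul_assoc]
  simp only [this]
  rw [Finset.sum_const, Finset.card_univ, Fintype.card_perm, Fintype.card_fin, nsmul_eq_mul]

theorem coeff_youngSymmetrizer_mul_self {h : ℂ}
    (hc : youngSymmetrizer T * youngSymmetrizer T = h • youngSymmetrizer T) :
    ∑ g, (youngSymmetrizer T).coeff g * (youngSymmetrizer T).coeff g⁻¹ = h := by
  have h1 := congrArg (fun x => x.coeff 1) hc
  simp only [coeff_mul_eq_sum, mul_one, MonoidAlgebra.coeff_smul, Finsupp.smul_apply,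
    coeff_youngSymmetrizer_one, smul_eq_mul] at h1
  exact h1

/-- `e * ℂ[S_n] * e` is one-dimensional for the idempotent `e` proportional to the Young
symmetrizer. -/
theorem sum_spechtCharacter_mul_self :
    ∑ g, spechtCharacter T g * spechtCharacter T g = n.factorial := by
  obtain ⟨h, hh, hc⟩ := exists_youngSymmetrizer_mul_self T
  rw [sum_spechtCharacter_mul T hh hc (isClassFunction_spechtCharacter T)]
  simp only [spechtCharacter_apply T hh hc]
  set c := youngSymmetrizer T with hcdef
  have hc1 : c.coeff 1 = 1 := coeff_youngSymmetrizer_one T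
  have key : ∀ y : Equiv.Perm (Fin n), ∑ g, c.coeff g * c.coeff (y⁻¹ * g⁻¹ * y) =
      h * (c.coeff y⁻¹ * c.coeff y) := by
    intro y
    obtain ⟨t, ht⟩ := exists_rowSymmetrizer_mul_mul T
      (colAntisymmetrizer T * MonoidAlgebra.single y 1 * rowSymmetrizer T)
    have ht' : c * MonoidAlgebra.single y 1 * c = t • c := by
      rw [hcdef, youngSymmetrizer, ← ht]; simp only [mul_assoc]
    have h1 : (c * MonoidAlgebra.single y 1 * c * MonoidAlgebra.single y⁻¹ 1).coeff 1 =
        ∑ g, c.coeff g * c.coeff (y⁻¹ * g⁻¹ * y) := by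
      rw [mul_assoc, mul_assoc, coeff_mul_eq_sum]
      refine Finset.sum_congr rfl fun g _ => ?_
      rw [coeff_single_one_mul, MonoidAlgebra.coeff_mul_single_apply]
      simp
    have h2 : t = h * c.coeff y⁻¹ := by
      have h3 := congrArg (fun x => x.coeff 1) ht'
      simp only [MonoidAlgebra.coeff_smul, Finsupp.smul_apply, hc1, smul_eq_mul, mul_one] at h3
      rw [← h3, mul_assoc, coeff_one_mul_comm, mul_assoc, hc, mul_smul_comm,
        MonoidAlgebra.coeff_smul, Finsupp.smul_apply, coeff_single_one_mul, smul_eq_mul, mul_one]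
    rw [← h1, ht', h2, smul_mul_assoc, MonoidAlgebra.coeff_smul, Finsupp.smul_apply,
      MonoidAlgebra.coeff_mul_single_apply, smul_eq_mul]
    simp [mul_assoc]
  have h4 : ∑ g, c.coeff g * (h⁻¹ * ∑ y, c.coeff (y⁻¹ * g⁻¹ * y)) = h := by
    simp only [Finset.mul_sum, mul_left_comm _ h⁻¹]
    rw [Finset.sum_comm]
    simp only [← Finset.mul_sum, key]
    rw [← mul_assoc, inv_mul_cancel₀ hh, one_mul, ← coeff_youngSymmetrizer_mul_self T hc]
    exact Finset.sum_congr rfl fun y _ => mul_comm _ _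
  rw [h4, mul_right_comm, inv_mul_cancel₀ hh, one_mul]

theorem coeff_youngSymmetrizer (x : Equiv.Perm (Fin n)) : (youngSymmetrizer T).coeff x =
    ∑ r : Equiv.Perm (Fin n) with r ∈ T.rowGroup, ∑ q : Equiv.Perm (Fin n) with q ∈ T.colGroup,
      if r * q = x then ((Equiv.Perm.sign q : ℤ) : ℂ) else 0 := by
  have h := sum_coeff_youngSymmetrizer_mul T fun g => if g = x then 1 else 0
  rw [Finset.sum_eq_single x (by intro b _ hb; simp [hb]) (by simp), if_pos rfl, mul_one] at h
  simpa using h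

theorem conj_coeff_youngSymmetrizer (x : Equiv.Perm (Fin n)) :
    starRingEnd ℂ ((youngSymmetrizer T).coeff x) = (youngSymmetrizer T).coeff x := by
  simp only [coeff_youngSymmetrizer, map_sum, apply_ite (starRingEnd ℂ), map_zero]
  simp

theorem conj_spechtCharacter (x : Equiv.Perm (Fin n)) :
    starRingEnd ℂ (spechtCharacter T x) = spechtCharacter T x := by
  obtain ⟨h, hh, hc⟩ := exists_youngSymmetrizer_mul_self T
  have h1 : starRingEnd ℂ h = h := by
    rw [← coeff_youngSymmetrizer_mul_self T hc]
    simp only [map_sum, map_mul, conj_coeff_youngSymmetrizer]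
  simp only [spechtCharacter_apply T hh hc, map_mul, map_inv₀, h1, map_sum,
    conj_coeff_youngSymmetrizer]

theorem conj_frobenius {N : ℕ} (a : Fin N → ℕ) (x : Equiv.Perm (Fin n)) :
    starRingEnd ℂ (frobenius N a x) = frobenius N a x := by
  simp only [frobenius, vandermondeCoeff, map_sum, apply_ite (starRingEnd ℂ), map_zero]
  simp

/-- If `f` takes the same value at two entries of a column, then their transposition cancels the
column permutations `q` with `f ∘ r ∘ q = f` in pairs. -/
theorem sum_sign_eq_zero {N : ℕ} (f : Fin n → Fin N) {i j : Fin n} (hij : i ≠ j)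
    (hf : f i = f j) (hcol : T.col i = T.col j) (r : Equiv.Perm (Fin n)) :
    ∑ q : Equiv.Perm (Fin n) with q ∈ T.colGroup,
      (if f ∘ (r * q) = f then ((Equiv.Perm.sign q : ℤ) : ℂ) else 0) = 0 := by
  have hs := T.swap_mem_colGroup hcol
  have hfs : f ∘ Equiv.swap i j = f := by
    funext x
    rw [Function.comp_apply, Equiv.swap_apply_def]
    split_ifs with h1 h2
    · rw [h1, hf]
    · rw [h2, hf]
    · rfl
  have hiff : ∀ q : Equiv.Perm (Fin n),
      f ∘ (r * (q * Equiv.swap i j) : Equiv.Perm (Fin n)) = f ↔ f ∘ (r * q) = f := by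
    have h1 : ∀ q : Equiv.Perm (Fin n), f ∘ (r * q) = f →
        f ∘ (r * (q * Equiv.swap i j) : Equiv.Perm (Fin n)) = f := by
      intro q hq
      rw [← mul_assoc, Equiv.Perm.coe_mul (r * q), ← Function.comp_assoc, hq, hfs]
    intro q
    refine ⟨fun h => ?_, h1 q⟩
    have := h1 _ h
    rwa [mul_assoc q, Equiv.swap_mul_self, mul_one] at this
  refine self_eq_neg.1 ?_
  rw [← Finset.sum_neg_distrib]
  refine Finset.sum_nbij' (fun q => q * Equiv.swap i j) (fun q => q * Equiv.swap i j)
    ?_ ?_ ?_ ?_ ?_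
  · intro q hq
    simp only [Finset.mem_filter, Finset.mem_univ, true_and] at hq ⊢
    exact T.colGroup.mul_mem hq hs
  · intro q hq
    simp only [Finset.mem_filter, Finset.mem_univ, true_and] at hq ⊢
    exact T.colGroup.mul_mem hq hs
  · intro q _; simp [mul_assoc]
  · intro q _; simp [mul_assoc]
  · intro q _
    have := hiff q
    simp only [this, Equiv.Perm.sign_mul, Equiv.Perm.sign_swap hij]
    split_ifs <;> simp

theorem sum_coeff_youngSymmetrizer_mul_wordCount {N : ℕ} (α : Fin N → ℕ) :
    ∑ g, (youngSymmetrizer T).coeff g * wordCount α g =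
      ∑ f : Fin n → Fin N with content f = α,
        ∑ r : Equiv.Perm (Fin n) with r ∈ T.rowGroup,
          ∑ q : Equiv.Perm (Fin n) with q ∈ T.colGroup,
            if f ∘ (r * q) = f then ((Equiv.Perm.sign q : ℤ) : ℂ) else 0 := by
  rw [sum_coeff_youngSymmetrizer_mul]
  have : ∀ r q : Equiv.Perm (Fin n), ((Equiv.Perm.sign q : ℤ) : ℂ) * wordCount α (r * q) =
      ∑ f : Fin n → Fin N with content f = α,
        if f ∘ (r * q) = f then ((Equiv.Perm.sign q : ℤ) : ℂ) else 0 := by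
    intro r q
    rw [wordCount, Finset.mul_sum, Finset.sum_filter, Finset.sum_filter]
    refine Finset.sum_congr rfl fun f _ => ?_
    split_ifs <;> simp_all
  simp only [this]
  rw [eq_comm, Finset.sum_comm]
  exact Finset.sum_congr rfl fun r _ => Finset.sum_comm

theorem card_lt_eq_sum_content {N : ℕ} (f : Fin n → Fin N) (s : ℕ) :
    Finset.card {i | (f i).val < s} = ∑ j : Fin N with j.val < s, content f j := by
  rw [Finset.card_eq_sum_card_fiberwise (f := f) (t := {j | j.val < s})
    (fun i hi => by simpa using hi)]
  refine Finset.sum_congr rfl fun j hj => ?_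
  simp only [Finset.mem_filter, Finset.mem_univ, true_and] at hj
  rw [content, Finset.filter_filter]
  congr 1
  ext i
  simp only [Finset.mem_filter, Finset.mem_univ, true_and, and_iff_right_iff_imp]
  rintro rfl
  exact hj

/-- The row function of `T` as a word in the letters `0, …, N - 1`. -/
def rowWord {N : ℕ} (hN : μ.rowLen N = 0) (i : Fin n) : Fin N :=
  ⟨T.row i, by
    by_contra h
    have h1 := YoungDiagram.mem_iff_lt_rowLen.1 (T.row_col_mem i)
    have h2 := μ.rowLen_anti N (T.row i) (by omega)
    omega⟩

theorem content_rowWord {N : ℕ} (hN : μ.rowLen N = 0) (i : Fin N) :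
    content (rowWord T hN) i = μ.rowLen i := by
  rw [← T.card_row i, content]
  congr 1
  ext x
  simp [rowWord, Fin.ext_iff]

theorem card_row_lt {N : ℕ} (hN : μ.rowLen N = 0) (s : ℕ) :
    Finset.card {i | T.row i < s} = ∑ j : Fin N with j.val < s, μ.rowLen j := by
  rw [← Finset.sum_congr rfl fun j _ => content_rowWord T hN j,
    ← card_lt_eq_sum_content (rowWord T hN)]
  rfl

/-- A word with too many small letters has two equal letters in one column of `T`. -/
theorem sum_coeff_youngSymmetrizer_mul_wordCount_eq_zero {N : ℕ} (hN : μ.rowLen N = 0)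
    (α : Fin N → ℕ) (s : ℕ)
    (hs : ∑ j : Fin N with j.val < s, μ.rowLen j < ∑ j : Fin N with j.val < s, α j) :
    ∑ g, (youngSymmetrizer T).coeff g * wordCount α g = 0 := by
  rw [sum_coeff_youngSymmetrizer_mul_wordCount]
  refine Finset.sum_eq_zero fun f hf => Finset.sum_eq_zero fun r _ => ?_
  simp only [Finset.mem_filter, Finset.mem_univ, true_and] at hf
  have h : ∃ i j, f i = f j ∧ T.col i = T.col j ∧ i ≠ j := by
    by_contra! h
    have h1 := T.card_lt_le (f := fun i => (f i).val) (fun i j h2 h3 => h i j (Fin.ext h2) h3) s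
    rw [card_lt_eq_sum_content, card_row_lt T hN, hf] at h1
    omega
  obtain ⟨i, j, h1, h2, h3⟩ := h
  exact sum_sign_eq_zero T f h3 h1 h2 r

/-- After the reduction to column permutations of the row word, the sum is the coefficient at the
identity of the square of the Young symmetrizer. -/
theorem sum_coeff_youngSymmetrizer_mul_wordCount_self {N : ℕ} (hN : μ.rowLen N = 0) {h : ℂ}
    (hc : youngSymmetrizer T * youngSymmetrizer T = h • youngSymmetrizer T) :
    ∑ g, (youngSymmetrizer T).coeff g * wordCount (fun i : Fin N => μ.rowLen i) g = h := by
  classical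
  rw [sum_coeff_youngSymmetrizer_mul_wordCount]
  -- The words that contribute are those obtained from the row word by a column permutation.
  have himage : ∀ F : (Fin n → Fin N) → ℂ,
      (∀ f i j, i ≠ j → f i = f j → T.col i = T.col j → F f = 0) →
      ∑ f : Fin n → Fin N with content f = fun i : Fin N => μ.rowLen i, F f =
        ∑ q : Equiv.Perm (Fin n) with q ∈ T.colGroup, F (rowWord T hN ∘ q) := by
    intro F hF
    rw [← Finset.sum_image (f := F) (g := fun q : Equiv.Perm (Fin n) => rowWord T hN ∘ q)]
    · symm
      refine Finset.sum_subset ?_ ?_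
      · intro f hf
        simp only [Finset.mem_image, Finset.mem_filter, Finset.mem_univ, true_and] at hf ⊢
        obtain ⟨q, -, rfl⟩ := hf
        rw [content_comp_perm]
        exact funext fun i => content_rowWord T hN i
      · intro f hf hf'
        by_contra h0
        refine hf' ?_
        simp only [Finset.mem_image, Finset.mem_filter, Finset.mem_univ, true_and] at hf ⊢
        obtain ⟨q, hq, hq'⟩ := T.exists_mem_colGroup (f := fun i => (f i).val)
          (fun i j h1 h2 => by
            by_contra h3
            exact h0 (hF f i j h3 (Fin.ext h1) h2))
          (fun s => by rw [card_lt_eq_sum_content, card_row_lt T hN, hf])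
        exact ⟨q, hq, funext fun i => Fin.ext (hq' i)⟩
    · intro q hq q' hq' h
      simp only [Finset.coe_filter, Finset.mem_univ, true_and, Set.mem_ofPred_eq] at hq hq'
      refine Equiv.ext fun i => T.eq_of_row_eq_of_col_eq ?_ ((hq i).trans (hq' i).symm)
      exact congrArg Fin.val (congrFun h i)
  rw [himage _ fun f i j hij h1 h2 =>
    Finset.sum_eq_zero fun r _ => sum_sign_eq_zero T f hij h1 h2 r]
  have hinner : ∀ q₀ ∈ ({q | q ∈ T.colGroup} : Finset (Equiv.Perm (Fin n))),
      ∀ r : Equiv.Perm (Fin n),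
      ∑ q : Equiv.Perm (Fin n) with q ∈ T.colGroup,
        (if (rowWord T hN ∘ q₀) ∘ (r * q) = rowWord T hN ∘ q₀
          then ((Equiv.Perm.sign q : ℤ) : ℂ) else 0) =
      ∑ p : Equiv.Perm (Fin n) with p ∈ T.colGroup,
        ∑ r' : Equiv.Perm (Fin n) with r' ∈ T.rowGroup,
          ((Equiv.Perm.sign q₀ : ℤ) : ℂ) *
            (if r * p = (r' * q₀)⁻¹ then ((Equiv.Perm.sign p : ℤ) : ℂ) else 0) := by
    intro q₀ hq₀ r
    simp only [Finset.mem_filter, Finset.mem_univ, true_and] at hq₀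
    refine Finset.sum_nbij' (fun q => q * q₀⁻¹) (fun p => p * q₀) ?_ ?_ ?_ ?_ ?_
    · intro q hq
      simp only [Finset.mem_filter, Finset.mem_univ, true_and] at hq ⊢
      exact T.colGroup.mul_mem hq (T.colGroup.inv_mem hq₀)
    · intro q hq
      simp only [Finset.mem_filter, Finset.mem_univ, true_and] at hq ⊢
      exact T.colGroup.mul_mem hq hq₀
    · intro q _; simp
    · intro q _; simp
    · intro q _
      have hiff : (rowWord T hN ∘ q₀) ∘ (r * q) = rowWord T hN ∘ q₀ ↔
          (q₀ * (r * (q * q₀⁻¹)))⁻¹ ∈ T.rowGroup := by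
        rw [inv_mem_iff, T.mem_rowGroup, funext_iff]
        constructor
        · intro h1 i
          have := congrArg Fin.val (h1 (q₀⁻¹ i))
          simpa [rowWord] using this
        · intro h1 i
          refine Fin.ext ?_
          simpa [rowWord] using h1 (q₀ i)
      have hiff' : ∀ r' : Equiv.Perm (Fin n), r * (q * q₀⁻¹) = (r' * q₀)⁻¹ ↔
          r' = (q₀ * (r * (q * q₀⁻¹)))⁻¹ := by
        intro r'
        rw [eq_inv_iff_mul_eq_one, eq_inv_iff_mul_eq_one, ← mul_assoc r',
          mul_eq_one_iff_eq_inv, mul_eq_one_iff_inv_eq, eq_comm]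
      simp only [hiff, hiff', Finset.sum_ite_eq', mul_ite, mul_zero, Finset.mem_filter,
        Finset.mem_univ, true_and]
      split_ifs
      · rw [Equiv.Perm.sign_mul, Equiv.Perm.sign_inv, Units.val_mul, Int.cast_mul,
          mul_left_comm, sign_mul_self, mul_one]
      · rfl
  rw [Finset.sum_congr rfl fun q₀ hq₀ => Finset.sum_congr rfl fun r _ => hinner q₀ hq₀ r,
    ← coeff_youngSymmetrizer_mul_self T hc,
    sum_coeff_youngSymmetrizer_mul T fun g => (youngSymmetrizer T).coeff g⁻¹]
  simp only [coeff_youngSymmetrizer, Finset.mul_sum]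
  conv_rhs => rw [Finset.sum_comm]
  refine Finset.sum_congr rfl fun q₀ _ => ?_
  conv_rhs => rw [Finset.sum_comm]
  exact Finset.sum_congr rfl fun r _ => Finset.sum_comm

/-- Frobenius' formula for Specht characters: both class functions have norm one, and their inner
product is one by the triangularity of the multiplicities in the permutation characters. -/
theorem spechtCharacter_eq_frobenius {N : ℕ} (hN : μ.rowLen N = 0) :
    spechtCharacter T = frobenius N ((fun i : Fin N => μ.rowLen i) + staircase N) := by
  have hsum : ∑ i : Fin N, μ.rowLen i = n := by
    rw [← Finset.sum_congr rfl fun j _ => content_rowWord T hN j, sum_content]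
  have hanti : Antitone fun i : Fin N => μ.rowLen i := fun i j hij => μ.rowLen_anti i j hij
  have h1 := sum_frobenius_mul_frobenius hanti hsum
  have h2 := sum_spechtCharacter_mul_self T
  obtain ⟨h, hh, hc⟩ := exists_youngSymmetrizer_mul_self T
  have h3 : ∑ x, spechtCharacter T x *
      frobenius N ((fun i : Fin N => μ.rowLen i) + staircase N) x = n.factorial := by
    refine sum_mul_frobenius_eq _ _ _ (fun α _ hα => ?_) ?_
    · obtain ⟨s, hs⟩ := hα.sum_lt
      rw [sum_spechtCharacter_mul T hh hc (isClassFunction_wordCount α),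
        sum_coeff_youngSymmetrizer_mul_wordCount_eq_zero T hN α s hs, mul_zero]
    · rw [sum_spechtCharacter_mul T hh hc (isClassFunction_wordCount _),
        sum_coeff_youngSymmetrizer_mul_wordCount_self T hN hc, mul_right_comm,
        inv_mul_cancel₀ hh, one_mul]
  set ω := frobenius (n := n) N ((fun i : Fin N => μ.rowLen i) + staircase N) with hω
  have h4 : ∑ x, (spechtCharacter T x - ω x) * (spechtCharacter T x - ω x) = 0 := by
    have : ∀ x, (spechtCharacter T x - ω x) * (spechtCharacter T x - ω x) =
        spechtCharacter T x * spechtCharacter T x - 2 * (spechtCharacter T x * ω x) +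
          ω x * ω x := fun x => by ring
    simp only [this, Finset.sum_add_distrib, Finset.sum_sub_distrib, ← Finset.mul_sum, h1, h2, h3]
    ring
  have hreal : ∀ x, ∃ t : ℝ, spechtCharacter T x - ω x = t := by
    intro x
    refine ⟨_, (Complex.conj_eq_iff_re.1 ?_).symm⟩
    rw [map_sub, conj_spechtCharacter, hω, conj_frobenius]
  choose d hd using hreal
  simp only [hd] at h4
  have h5 : ∑ x, d x * d x = 0 := by exact_mod_cast h4
  funext x
  have h6 := (Finset.sum_eq_zero_iff_of_nonneg fun x _ => mul_self_nonneg (d x)).1 h5 x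
    (Finset.mem_univ x)
  rw [← sub_eq_zero, hd, mul_self_eq_zero.1 h6, Complex.ofReal_zero]

end Specht

/-! ### Partitions and their row lengths -/

theorem rowLen_ofRowLens_eq_getD {w : List ℕ} (hw : w.SortedGE) (i : ℕ) :
    (YoungDiagram.ofRowLens w hw).rowLen i = w.getD i 0 := by
  refine eq_of_forall_lt_iff fun j => ?_
  rw [← YoungDiagram.mem_iff_lt_rowLen, YoungDiagram.mem_ofRowLens, List.getD_eq_getElem?_getD]
  by_cases h : i < w.length
  · simp [h]
  · simp [h]

theorem getD_filter_ne_zero {w : List ℕ} (hw : w.SortedGE) (i : ℕ) :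
    (w.filter (· ≠ 0)).getD i 0 = w.getD i 0 := by
  induction w generalizing i with
  | nil => rfl
  | cons a w ih =>
    have hw' := List.sortedGE_iff_pairwise.1 hw
    rw [List.pairwise_cons] at hw'
    have ih' := ih (List.sortedGE_iff_pairwise.2 hw'.2)
    by_cases ha : a = 0
    · have hz : ∀ b ∈ a :: w, b = 0 := by
        intro b hb
        rcases List.mem_cons.1 hb with rfl | hb
        · exact ha
        · have := hw'.1 b hb
          omega
      rw [List.filter_eq_nil_iff.2 (fun b hb => by simp [hz b hb])]
      rw [List.getD_eq_getElem?_getD, List.getD_eq_getElem?_getD]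
      by_cases h : i < (a :: w).length
      · rw [List.getElem?_eq_getElem h, Option.getD_some, hz _ (List.getElem_mem h)]
        simp
      · rw [List.getElem?_nil, Option.getD_none, List.getElem?_eq_none (not_lt.1 h),
          Option.getD_none]
    · rw [List.filter_cons_of_pos (by simpa using ha)]
      cases i with
      | zero => rfl
      | succ i => simpa using ih' i

theorem rowLen_diagram_ofSums {n : ℕ} {w : List ℕ} (hw : w.SortedGE)
    (h : (w : Multiset ℕ).sum = n) (i : ℕ) :
    (diagram (Nat.Partition.ofSums n (w : Multiset ℕ) h)).rowLen i = w.getD i 0 := by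
  rw [diagram, rowLen_ofRowLens_eq_getD, ← getD_filter_ne_zero hw]
  congr 1
  refine List.Perm.eq_of_pairwise' (r := (· ≥ ·)) ?_ ?_ ?_
  · exact Multiset.pairwise_sort _ _
  · exact (List.sortedGE_iff_pairwise.1 hw).filter _
  · rw [← Multiset.coe_eq_coe, Multiset.sort_eq]
    simp [Nat.Partition.ofSums]

theorem exists_partition {n : ℕ} (N : ℕ) {f : ℕ → ℕ} (hf : Antitone f) (hN : f N = 0)
    (hn : ∑ i ∈ Finset.range N, f i = n) :
    ∃ p : n.Partition, ∀ i, (diagram p).rowLen i = f i := by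
  have hw : ((List.range N).map f).SortedGE := by
    rw [List.sortedGE_iff_pairwise, List.pairwise_map]
    exact List.pairwise_lt_range.imp fun h => hf h.le
  have hs : (((List.range N).map f : List ℕ) : Multiset ℕ).sum = n := by
    rw [← hn]; rfl
  refine ⟨Nat.Partition.ofSums n _ hs, fun i => ?_⟩
  rw [rowLen_diagram_ofSums hw, List.getD_eq_getElem?_getD]
  by_cases h : i < N
  · simp [h]
  · have := hf (not_lt.1 h)
    simp [h]
    omega

theorem partition_ext {n : ℕ} {p q : n.Partition}
    (h : ∀ i, (diagram p).rowLen i = (diagram q).rowLen i) : p = q := by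
  have hd : diagram p = diagram q := by
    ext ⟨i, j⟩
    rw [YoungDiagram.mem_cells, YoungDiagram.mem_cells, YoungDiagram.mem_iff_lt_rowLen,
      YoungDiagram.mem_iff_lt_rowLen, h]
  have hl : ∀ p : n.Partition, (diagram p).rowLens = p.parts.sort (· ≥ ·) := fun p =>
    YoungDiagram.rowLens_ofRowLens_eq_self fun x hx => p.parts_pos ((Multiset.mem_sort _).1 hx)
  have h1 : p.parts.sort (· ≥ ·) = q.parts.sort (· ≥ ·) := by rw [← hl p, ← hl q, hd]
  refine Nat.Partition.ext ?_
  rw [← Multiset.sort_eq p.parts (· ≥ ·), h1, Multiset.sort_eq]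

theorem rowLen_eq_zero {n : ℕ} (p : n.Partition) {N : ℕ} (h : n ≤ N) :
    (diagram p).rowLen N = 0 := by
  by_contra h0
  have h1 : (N, 0) ∈ diagram p := YoungDiagram.mem_iff_lt_rowLen.2 (by omega)
  rw [YoungDiagram.mem_iff_lt_colLen, YoungDiagram.colLen_eq_card] at h1
  have h2 : ((diagram p).col 0).card ≤ (diagram p).card :=
    Finset.card_le_card (Finset.filter_subset _ _)
  rw [card_diagram] at h2
  omega

theorem sum_rowLen {n : ℕ} (p : n.Partition) {N : ℕ} (h : (diagram p).rowLen N = 0) :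
    ∑ i : Fin N, (diagram p).rowLen i = n := by
  rw [← Finset.sum_congr rfl fun j _ => content_rowWord (someFilling p) h j, sum_content]

theorem sum_range_rowLen {n : ℕ} (p : n.Partition) {N : ℕ} (h : (diagram p).rowLen N = 0) :
    ∑ i ∈ Finset.range N, (diagram p).rowLen i = n := by
  rw [Finset.sum_range, sum_rowLen p h]

/-! ### Orthogonality and completeness of the irreducible characters -/

theorem irrChar_eq_frobenius {n : ℕ} (p : n.Partition) {N : ℕ} (h : (diagram p).rowLen N = 0) :
    irrChar p = frobenius N ((fun i : Fin N => (diagram p).rowLen i) + staircase N) :=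
  spechtCharacter_eq_frobenius _ h

theorem isClassFunction_irrChar {n : ℕ} (p : n.Partition) : IsClassFunction (irrChar p) :=
  isClassFunction_spechtCharacter _

theorem sum_irrChar_mul_irrChar_of_lexGT {n : ℕ} (p q : n.Partition)
    (h : LexGT (fun i : Fin n => (diagram q).rowLen i) (fun i : Fin n => (diagram p).rowLen i)) :
    ∑ x, irrChar p x * irrChar q x = 0 := by
  obtain ⟨c, hc, hcc⟩ := exists_youngSymmetrizer_mul_self (someFilling p)
  have key : ∀ α : Fin n → ℕ, LexGT α (fun i : Fin n => (diagram p).rowLen i) →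
      ∑ x, irrChar p x * wordCount α x = 0 := by
    intro α hα
    obtain ⟨s, hs⟩ := hα.sum_lt
    rw [irrChar, sum_spechtCharacter_mul _ hc hcc (isClassFunction_wordCount α),
      sum_coeff_youngSymmetrizer_mul_wordCount_eq_zero _ (rowLen_eq_zero p le_rfl) α s hs, mul_zero]
  rw [irrChar_eq_frobenius q (rowLen_eq_zero q le_rfl)]
  exact sum_mul_frobenius_eq _ _ _ (fun α _ hα => key α (hα.trans h)) (key _ h)

theorem sum_irrChar_mul_irrChar {n : ℕ} (p q : n.Partition) :
    ∑ x, irrChar p x * irrChar q x = if p = q then (n.factorial : ℂ) else 0 := by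
  split_ifs with h
  · rw [h]; exact sum_spechtCharacter_mul_self _
  · have hne : (fun i : Fin n => (diagram p).rowLen i) ≠ fun i : Fin n => (diagram q).rowLen i := by
      intro h1
      refine h (partition_ext fun i => ?_)
      rcases lt_or_ge i n with hi | hi
      · exact congrFun h1 ⟨i, hi⟩
      · rw [rowLen_eq_zero p hi, rowLen_eq_zero q hi]
    rcases lexGT_or_lexGT hne with h1 | h1
    · rw [← sum_irrChar_mul_irrChar_of_lexGT q p h1]
      exact Finset.sum_congr rfl fun x _ => mul_comm _ _
    · exact sum_irrChar_mul_irrChar_of_lexGT p q h1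

theorem factorial_cast_ne_zero (n : ℕ) : (n.factorial : ℂ) ≠ 0 :=
  Nat.cast_ne_zero.2 n.factorial_ne_zero

/-- Orthogonality makes the irreducible characters linearly independent; there are as many of them
as cycle types, hence they span the class functions. -/
theorem IsClassFunction.eq_zero {n : ℕ} {φ : Equiv.Perm (Fin n) → ℂ} (hφ : IsClassFunction φ)
    (h : ∀ p : n.Partition, ∑ x, φ x * irrChar p x = 0) : φ = 0 := by
  -- Class functions are viewed as functions of the cycle type; off the cycle types the junk value
  -- is zero.
  let ext : (Equiv.Perm (Fin n) → ℂ) → ((Fintype.card (Fin n)).Partition → ℂ) := fun ψ =>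
    Function.extend (fun x : Equiv.Perm (Fin n) => x.partition) ψ fun _ => 0
  have hext : ∀ ψ, IsClassFunction ψ → ∀ x, ext ψ (Equiv.Perm.partition x) = ψ x := by
    intro ψ hψ x
    refine Function.FactorsThrough.extend_apply (fun x y hxy => ?_) _ x
    exact hψ.apply_eq_of_isConj (Equiv.Perm.partition_eq_of_isConj.2 hxy)
  have hcoef : ∀ (g : n.Partition → ℂ) (q : n.Partition),
      ∑ x, (∑ p, g p * irrChar p x) * irrChar q x = g q * n.factorial := by
    intro g q
    simp only [Finset.sum_mul]
    rw [Finset.sum_comm]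
    simp only [mul_assoc, ← Finset.mul_sum, sum_irrChar_mul_irrChar]
    simp
  have hli : LinearIndependent ℂ fun p : n.Partition => ext (irrChar p) := by
    rw [Fintype.linearIndependent_iff]
    intro g hg q
    have h1 : ∀ x : Equiv.Perm (Fin n), ∑ p, g p * irrChar p x = 0 := by
      intro x
      have := congrFun hg (Equiv.Perm.partition x)
      simpa [hext _ (isClassFunction_irrChar _)] using this
    have h2 := hcoef g q
    simp only [h1, zero_mul, Finset.sum_const_zero] at h2
    exact (mul_eq_zero.1 h2.symm).resolve_right (factorial_cast_ne_zero n)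
  have hspan := hli.span_eq_top_of_card_eq_finrank' (by
    rw [Module.finrank_fintype_fun_eq_card, Fintype.card_fin])
  have hmem : ext φ ∈ Submodule.span ℂ (Set.range fun p : n.Partition => ext (irrChar p)) := by
    rw [hspan]; trivial
  obtain ⟨g, hg⟩ := (Submodule.mem_span_range_iff_exists_fun ℂ).1 hmem
  have hφg : ∀ x, φ x = ∑ p, g p * irrChar p x := by
    intro x
    have := congrFun hg (Equiv.Perm.partition x)
    rw [hext φ hφ] at this
    rw [← this]
    simp [hext _ (isClassFunction_irrChar _)]
  funext x
  rw [hφg x]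
  refine Finset.sum_eq_zero fun q _ => ?_
  have h2 := hcoef g q
  simp only [← hφg, h q] at h2
  rw [(mul_eq_zero.1 h2.symm).resolve_right (factorial_cast_ne_zero n), zero_mul]

theorem IsClassFunction.sub {n : ℕ} {φ ψ : Equiv.Perm (Fin n) → ℂ} (hφ : IsClassFunction φ)
    (hψ : IsClassFunction ψ) : IsClassFunction (φ - ψ) := fun x y => by
  simp only [Pi.sub_apply, hφ x y, hψ x y]

theorem IsClassFunction.add {n : ℕ} {φ ψ : Equiv.Perm (Fin n) → ℂ} (hφ : IsClassFunction φ)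
    (hψ : IsClassFunction ψ) : IsClassFunction (φ + ψ) := fun x y => by
  simp only [Pi.add_apply, hφ x y, hψ x y]

theorem IsClassFunction.smul {n : ℕ} {φ : Equiv.Perm (Fin n) → ℂ} (hφ : IsClassFunction φ)
    (c : ℂ) : IsClassFunction (c • φ) := fun x y => by
  simp only [Pi.smul_apply, hφ x y]

theorem IsClassFunction.sum {n : ℕ} {κ : Type*} (s : Finset κ) {φ : κ → Equiv.Perm (Fin n) → ℂ}
    (hφ : ∀ i ∈ s, IsClassFunction (φ i)) : IsClassFunction (∑ i ∈ s, φ i) := fun x y => by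
  simp only [Finset.sum_apply]
  exact Finset.sum_congr rfl fun i hi => hφ i hi x y

theorem IsClassFunction.ext {n : ℕ} {φ ψ : Equiv.Perm (Fin n) → ℂ} (hφ : IsClassFunction φ)
    (hψ : IsClassFunction ψ)
    (h : ∀ p : n.Partition, ∑ x, φ x * irrChar p x = ∑ x, ψ x * irrChar p x) : φ = ψ := by
  rw [← sub_eq_zero]
  refine (hφ.sub hψ).eq_zero fun p => ?_
  simp only [Pi.sub_apply, sub_mul, Finset.sum_sub_distrib, h p, sub_self]

/-! ### Horizontal strips and outer products with a trivial character -/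

/-- The row lengths of `v` and `p` interlace, that is, the skew shape `p / v` is a horizontal
strip. -/
def IsHorizontalStrip {m n : ℕ} (v : m.Partition) (p : n.Partition) : Prop :=
  ∀ i, (diagram v).rowLen i ≤ (diagram p).rowLen i ∧
    (diagram p).rowLen (i + 1) ≤ (diagram v).rowLen i

open scoped Classical in
/-- Dual Pieri rule for the restriction of irreducible characters to `S_m × S_k`. -/
theorem sum_irrChar_youngEmbedding {m k n : ℕ} (h : m + k = n) (p : n.Partition)
    (y : Equiv.Perm (Fin m)) :
    ∑ z : Equiv.Perm (Fin k), irrChar p (youngEmbedding h (y, z)) =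
      (k.factorial : ℂ) * ∑ v : m.Partition with IsHorizontalStrip v p, irrChar v y := by
  have hn := rowLen_eq_zero p le_rfl
  have hm : ∀ v : m.Partition, (diagram v).rowLen n = 0 := fun v => rowLen_eq_zero v (by omega)
  rw [irrChar_eq_frobenius p hn, sum_frobenius_youngEmbedding,
    (isAlternating_frobenius y).stripSum_add_staircase k
      (fun i j hij => (diagram p).rowLen_anti i j hij)]
  congr 1
  symm
  refine Finset.sum_bij (fun v _ => fun i : Fin n => (diagram v).rowLen i) ?_ ?_ ?_ ?_
  · intro v hv
    simp only [Finset.mem_filter, Finset.mem_univ, true_and, Finset.mem_Iic] at hv ⊢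
    refine ⟨fun i => (hv i).1, fun i j hij => ?_, ?_⟩
    · have hij' : i.val < j.val := hij
      exact ((diagram p).rowLen_anti _ _ hij').trans (hv i).2
    · rw [sum_rowLen v (hm v), sum_rowLen p hn, h]
  · intro v _ v' _ hvv
    refine partition_ext fun i => ?_
    rcases lt_or_ge i n with hi | hi
    · exact congrFun hvv ⟨i, hi⟩
    · rw [rowLen_eq_zero v (by omega), rowLen_eq_zero v' (by omega)]
  · intro v hv
    simp only [Finset.mem_filter, Finset.mem_Iic] at hv
    obtain ⟨hv1, hv2, hv3⟩ := hv
    let f : ℕ → ℕ := fun i => if hi : i < n then v ⟨i, hi⟩ else 0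
    have hf : Antitone f := by
      refine antitone_iff_forall_lt.2 fun i j hij => ?_
      simp only [f]
      by_cases hj : j < n
      · rw [dif_pos hj, dif_pos (hij.trans hj)]
        exact (hv1 _).trans (hv2 ⟨i, hij.trans hj⟩ ⟨j, hj⟩ hij)
      · rw [dif_neg hj]; exact Nat.zero_le _
    obtain ⟨q, hq⟩ := exists_partition (n := m) n hf (by simp [f]) (by
      have hv4 := hv3.trans ((sum_rowLen p hn).trans h.symm)
      rw [Finset.sum_range]
      simp only [f, Fin.is_lt, dif_pos, Fin.eta]
      omega)
    refine ⟨q, ?_, ?_⟩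
    · simp only [Finset.mem_filter, Finset.mem_univ, true_and]
      intro i
      rw [hq]
      simp only [f]
      by_cases hi : i < n
      · rw [dif_pos hi]
        refine ⟨hv1 _, ?_⟩
        by_cases hi' : i + 1 < n
        · exact hv2 ⟨i, hi⟩ ⟨i + 1, hi'⟩ (Fin.lt_def.2 (by simp))
        · rw [rowLen_eq_zero p (by omega)]; exact Nat.zero_le _
      · rw [dif_neg hi, rowLen_eq_zero p (N := i + 1) (by omega)]
        exact ⟨Nat.zero_le _, le_rfl⟩
    · funext i
      rw [hq]
      simp [f]
  · intro v _
    rw [irrChar_eq_frobenius v (hm v)]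

theorem isClassFunction_outerProduct {m k n : ℕ} (h : m + k = n) (f : Equiv.Perm (Fin m) → ℂ)
    (g : Equiv.Perm (Fin k) → ℂ) : IsClassFunction (outerProduct h f g) := by
  intro x t
  simp only [outerProduct]
  congr 1
  refine Fintype.sum_equiv (Equiv.mulLeft t⁻¹) _ _ fun y => ?_
  simp [mul_assoc]

/-- Frobenius reciprocity. -/
theorem sum_outerProduct_mul {m k n : ℕ} (h : m + k = n) (f : Equiv.Perm (Fin m) → ℂ)
    (g : Equiv.Perm (Fin k) → ℂ) {φ : Equiv.Perm (Fin n) → ℂ} (hφ : IsClassFunction φ) :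
    ∑ x, outerProduct h f g x * φ x =
      n.factorial / (m.factorial * k.factorial) *
        ∑ y, ∑ z, f y * g z * φ (youngEmbedding h (y, z)) := by
  simp only [outerProduct, mul_assoc, ← Finset.mul_sum, Finset.sum_mul]
  have : ∀ y : Equiv.Perm (Fin n), ∑ x, ∑ s : Equiv.Perm (Fin m) × Equiv.Perm (Fin k),
      (if youngEmbedding h s = y⁻¹ * (x * y) then f s.1 * g s.2 else 0) * φ x =
        ∑ s : Equiv.Perm (Fin m) × Equiv.Perm (Fin k),
          f s.1 * (g s.2 * φ (youngEmbedding h s)) := by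
    intro y
    rw [Finset.sum_comm]
    refine Finset.sum_congr rfl fun s _ => ?_
    rw [Finset.sum_eq_single (y * youngEmbedding h s * y⁻¹)]
    · rw [if_pos (by simp [mul_assoc]), hφ, mul_assoc]
    · intro x _ hx
      rw [if_neg, zero_mul]
      intro h'
      refine hx ?_
      rw [h']; simp [mul_assoc]
    · simp
  rw [Finset.sum_comm]
  simp only [this]
  rw [Finset.sum_const, Finset.card_univ, Fintype.card_perm, Fintype.card_fin, nsmul_eq_mul,
    Fintype.sum_prod_type]
  simp only [Finset.mul_sum]
  refine Finset.sum_congr rfl fun y _ => Finset.sum_congr rfl fun z _ => ?_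
  ring

open scoped Classical in
/-- Pieri's rule, as a formula for multiplicities. -/
theorem sum_outerProduct_one_mul_irrChar {m k n : ℕ} (h : m + k = n)
    (f : Equiv.Perm (Fin m) → ℂ) (p : n.Partition) :
    ∑ x, outerProduct h f 1 x * irrChar p x =
      n.factorial / m.factorial *
        ∑ v : m.Partition with IsHorizontalStrip v p, ∑ y, f y * irrChar v y := by
  rw [sum_outerProduct_mul h f 1 (isClassFunction_irrChar p)]
  simp only [Pi.one_apply, mul_one, ← Finset.mul_sum, sum_irrChar_youngEmbedding]
  rw [Finset.sum_comm]
  simp only [← Finset.mul_sum, mul_left_comm _ (k.factorial : ℂ)]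
  rw [← mul_assoc]
  congr 1
  have hk := factorial_cast_ne_zero k
  have hm := factorial_cast_ne_zero m
  field_simp

theorem irrChar_indiscrete (n : ℕ) : irrChar (Nat.Partition.indiscrete n) = 1 := by
  set T := someFilling (Nat.Partition.indiscrete n) with hT
  have hrow : ∀ i, T.row i = 0 := by
    intro i
    by_contra h
    have h1 := YoungDiagram.mem_iff_lt_rowLen.1 (T.row_col_mem i)
    have h2 := (diagram (Nat.Partition.indiscrete n)).rowLen_anti 1 (T.row i) (by omega)
    have h3 : (diagram (Nat.Partition.indiscrete n)).rowLen 1 = 0 :=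
      (rowLen_diagram_ofSums (w := [n]) (List.sortedGE_iff_pairwise.2 (List.pairwise_singleton _ _))
      (by simp) 1).trans rfl
    omega
  have hc : ∀ g, (youngSymmetrizer T).coeff g = 1 := by
    intro g
    rw [coeff_youngSymmetrizer, Finset.sum_eq_single g, Finset.sum_eq_single 1]
    · simp
    · intro q hq hq1
      refine absurd (T.eq_one_of_mem_of_mem (fun i => ?_) (by simpa using hq)) hq1
      rw [hrow, hrow]
    · intro h; exact absurd (by simp) h
    · intro r _ hr
      refine Finset.sum_eq_zero fun q hq => ?_
      rw [T.eq_one_of_mem_of_mem (s := q) (fun i => by rw [hrow, hrow]) (by simpa using hq),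
        mul_one, if_neg hr]
    · intro h
      exact absurd (by simp [T.mem_rowGroup, hrow]) h
  obtain ⟨h, hh, hcc⟩ := exists_youngSymmetrizer_mul_self T
  have hh' : h = n.factorial := by
    rw [← coeff_youngSymmetrizer_mul_self T hcc]
    simp [hc, Fintype.card_perm]
  funext g
  rw [irrChar, ← hT, spechtCharacter_apply T hh hcc, hh']
  simp only [hc, Finset.sum_const, Finset.card_univ, Fintype.card_perm, Fintype.card_fin,
    nsmul_eq_mul, mul_one]
  exact inv_mul_cancel₀ (factorial_cast_ne_zero n)

/-! ### Degrees and standard Young tableaux -/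

section RemoveLast

variable {n : ℕ} {μ ν : YoungDiagram} {c₀ : ℕ × ℕ}

theorem Filling.card_cells (T : Filling n μ) : μ.cells.card = n := by
  simpa using Fintype.card_congr T

theorem mem_and_ne_of_cells_eq (hν : ν.cells = μ.cells.erase c₀) {c : ℕ × ℕ} (hc : c ∈ ν.cells) :
    c ∈ μ.cells ∧ c ≠ c₀ := by
  rw [hν, Finset.mem_erase] at hc
  exact hc.symm

/-- Standard fillings of `μ` whose largest entry is in the cell `c₀` correspond to standard fillings
of the diagram without that cell. -/
noncomputable def removeLastEquiv (hc₀ : c₀ ∈ μ.cells) (hν : ν.cells = μ.cells.erase c₀) :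
    {T : Filling (n + 1) μ // T.IsStandard ∧ (T.symm (Fin.last n)).1 = c₀} ≃
      {S : Filling n ν // S.IsStandard} where
  toFun T :=
    have hne : ∀ c : {c // c ∈ ν.cells}, T.1 ⟨c.1, (mem_and_ne_of_cells_eq hν c.2).1⟩ ≠ Fin.last n := by
      intro c h
      have h1 := (Equiv.symm_apply_eq T.1).2 h.symm
      have h2 := T.2.2
      rw [h1] at h2
      exact (mem_and_ne_of_cells_eq hν c.2).2 h2
    have hbij : Function.Bijective fun c : {c // c ∈ ν.cells} => (T.1 ⟨c.1, (mem_and_ne_of_cells_eq hν c.2).1⟩).castPred (hne c) := by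
      rw [Fintype.bijective_iff_injective_and_card]
      refine ⟨fun c d h => ?_, ?_⟩
      · have h1 := T.1.injective (Fin.castPred_inj.1 h)
        exact Subtype.ext (Subtype.mk.inj h1)
      · rw [Fintype.card_coe, hν, Finset.card_erase_of_mem hc₀, T.1.card_cells]
        simp
    ⟨Equiv.ofBijective _ hbij, by
      refine ⟨fun c d h1 h2 => ?_, fun c d h1 h2 => ?_⟩
      · simp only [Equiv.ofBijective_apply, Fin.castPred_lt_castPred_iff]
        exact T.2.1.1 _ _ h1 h2
      · simp only [Equiv.ofBijective_apply, Fin.castPred_lt_castPred_iff]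
        exact T.2.1.2 _ _ h1 h2⟩
  invFun S :=
    have hmem : ∀ c : {c // c ∈ μ.cells}, c.1 ≠ c₀ → c.1 ∈ ν.cells := fun c h => by
      rw [hν]; exact Finset.mem_erase.2 ⟨h, c.2⟩
    have hnot : c₀ ∉ ν.cells := by rw [hν]; exact Finset.notMem_erase _ _
    have hbij : Function.Bijective fun c : {c // c ∈ μ.cells} =>
        if h : c.1 = c₀ then Fin.last n else (S.1 ⟨c.1, hmem c h⟩).castSucc := by
      rw [Fintype.bijective_iff_injective_and_card]
      refine ⟨fun c d h => ?_, ?_⟩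
      · simp only [] at h
        split_ifs at h with h1 h2 h2
        · exact Subtype.ext (h1.trans h2.symm)
        · exact absurd h.symm (Fin.castSucc_ne_last _)
        · exact absurd h (Fin.castSucc_ne_last _)
        · have h3 := S.1.injective (Fin.castSucc_injective _ h)
          exact Subtype.ext (Subtype.mk.inj h3)
      · have h1 := S.1.card_cells
        rw [hν, Finset.card_erase_of_mem hc₀] at h1
        have h2 := Finset.card_pos.2 ⟨c₀, hc₀⟩
        rw [Fintype.card_coe, Fintype.card_fin]
        omega
    ⟨Equiv.ofBijective _ hbij, by
      refine ⟨⟨fun c d h1 h2 => ?_, fun c d h1 h2 => ?_⟩, ?_⟩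
      · simp only [Equiv.ofBijective_apply]
        split_ifs with h3 h4 h4
        · rw [h3, h4] at h2; exact absurd h2 (lt_irrefl _)
        · refine absurd ?_ hnot
          rw [← h3]
          exact ν.up_left_mem h1.le h2.le (hmem d h4)
        · exact Fin.castSucc_lt_last _
        · exact Fin.castSucc_lt_castSucc_iff.2 (S.2.1 _ _ h1 h2)
      · simp only [Equiv.ofBijective_apply]
        split_ifs with h3 h4 h4
        · rw [h3, h4] at h2; exact absurd h2 (lt_irrefl _)
        · refine absurd ?_ hnot
          rw [← h3]
          exact ν.up_left_mem h2.le h1.le (hmem d h4)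
        · exact Fin.castSucc_lt_last _
        · exact Fin.castSucc_lt_castSucc_iff.2 (S.2.2 _ _ h1 h2)
      · have : (Equiv.ofBijective _ hbij).symm (Fin.last n) = ⟨c₀, hc₀⟩ := by
          rw [Equiv.symm_apply_eq]
          simp
        rw [this]⟩
  left_inv T := by
    refine Subtype.ext (Equiv.ext fun c => ?_)
    simp only [Equiv.ofBijective_apply]
    split_ifs with h
    · rw [← T.1.symm_apply_eq]
      exact Subtype.ext (T.2.2.trans h.symm)
    · simp
  right_inv S := by
    refine Subtype.ext (Equiv.ext fun c => ?_)
    simp only [Equiv.ofBijective_apply]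
    apply Fin.castSucc_injective
    simp [(mem_and_ne_of_cells_eq hν c.2).2]

end RemoveLast

theorem IsHorizontalStrip.cells_subset {m n : ℕ} {v : m.Partition} {p : n.Partition}
    (h : IsHorizontalStrip v p) : (diagram v).cells ⊆ (diagram p).cells := by
  rintro ⟨i, j⟩ hc
  rw [YoungDiagram.mem_cells, YoungDiagram.mem_iff_lt_rowLen] at hc ⊢
  exact hc.trans_le (h i).1

theorem IsHorizontalStrip.cells_eq_erase {n : ℕ} {v : n.Partition} {p : (n + 1).Partition}
    (h : IsHorizontalStrip v p) {c : ℕ × ℕ} (hc : c ∈ (diagram p).cells)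
    (hc' : c ∉ (diagram v).cells) : (diagram v).cells = (diagram p).cells.erase c := by
  refine Finset.eq_of_subset_of_card_le (fun d hd => ?_) ?_
  · exact Finset.mem_erase.2 ⟨fun h' => hc' (h' ▸ hd), h.cells_subset hd⟩
  · rw [Finset.card_erase_of_mem hc]
    exact (by rw [card_diagram v, card_diagram p]; rfl :
      (diagram p).card - 1 = (diagram v).card).le

theorem Filling.IsStandard.exists_isHorizontalStrip {n : ℕ} {p : (n + 1).Partition}
    {T : Filling (n + 1) (diagram p)} (hT : T.IsStandard) :
    ∃ v : n.Partition, IsHorizontalStrip v p ∧ (T.symm (Fin.last n)).1 ∉ (diagram v).cells := by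
  obtain ⟨⟨⟨r, c⟩, hc⟩, hl⟩ : ∃ c, c = T.symm (Fin.last n) := ⟨_, rfl⟩
  have hTl : T ⟨(r, c), hc⟩ = Fin.last n := by rw [hl]; simp
  rw [← hl]
  -- The cell of the largest entry is a corner.
  have hrow : (diagram p).rowLen r = c + 1 := by
    have h1 : c < (diagram p).rowLen r := YoungDiagram.mem_iff_lt_rowLen.1 hc
    by_contra h2
    have h3 : (r, c + 1) ∈ (diagram p).cells :=
      YoungDiagram.mem_iff_lt_rowLen.2 (by omega)
    have h4 := hT.1 ⟨(r, c), hc⟩ ⟨(r, c + 1), h3⟩ rfl (Nat.lt_succ_self c)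
    rw [hTl] at h4
    exact absurd (Fin.le_last _) (not_le.2 h4)
  have hnext : (diagram p).rowLen (r + 1) ≤ c := by
    by_contra h2
    have h3 : (r + 1, c) ∈ (diagram p).cells :=
      YoungDiagram.mem_iff_lt_rowLen.2 (by omega)
    have h4 := hT.2 ⟨(r, c), hc⟩ ⟨(r + 1, c), h3⟩ rfl (Nat.lt_succ_self r)
    rw [hTl] at h4
    exact absurd (Fin.le_last _) (not_le.2 h4)
  have hmono : ∀ i, (diagram p).rowLen (i + 1) ≤ (diagram p).rowLen i := fun i =>
    (diagram p).rowLen_anti _ _ (Nat.le_succ i)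
  let f : ℕ → ℕ := fun i => if i = r then c else (diagram p).rowLen i
  have hf : Antitone f := by
    refine antitone_nat_of_succ_le fun i => ?_
    simp only [f]
    have := hmono i
    split_ifs with h1 h2 h2
    · omega
    · rw [h1, hrow] at this; omega
    · rw [h2]; exact hnext
    · exact this
  have hz := rowLen_eq_zero p le_rfl
  have hr : r < n + 1 := by
    by_contra h
    rw [rowLen_eq_zero p (by omega)] at hrow
    omega
  obtain ⟨v, hv⟩ := exists_partition (n := n) (n + 1) hf
    (by simp only [f]; rw [if_neg (by omega), hz]) (by
      have h1 := sum_range_rowLen p hz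
      have h2 : ∀ i, (diagram p).rowLen i = f i + if i = r then 1 else 0 := by
        intro i
        simp only [f]
        split_ifs with h
        · rw [h, hrow]
        · rfl
      simp only [h2, Finset.sum_add_distrib, Finset.sum_ite_eq', Finset.mem_range, hr,
        if_true] at h1
      omega)
  refine ⟨v, fun i => ?_, fun h => ?_⟩
  · rw [hv]
    simp only [f]
    split_ifs with h
    · rw [h]; exact ⟨by omega, hnext⟩
    · exact ⟨le_rfl, hmono i⟩
  · rw [YoungDiagram.mem_cells, YoungDiagram.mem_iff_lt_rowLen, hv] at h
    simp [f] at h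

open scoped Classical in
/-- The branching rule for standard Young tableaux: remove the largest entry. -/
theorem numSYT_succ {n : ℕ} (p : (n + 1).Partition) :
    numSYT p = ∑ v : n.Partition with IsHorizontalStrip v p, numSYT v := by
  let F : (Σ v : {v : n.Partition // IsHorizontalStrip v p},
      {T : Filling (n + 1) (diagram p) // T.IsStandard ∧
        (T.symm (Fin.last n)).1 ∉ (diagram v.1).cells}) →
      {T : Filling (n + 1) (diagram p) // T.IsStandard} := fun x => ⟨x.2.1, x.2.2.1⟩
  have hF : Function.Bijective F := by
    constructor
    · rintro ⟨⟨v, hv⟩, ⟨T, hT, hTv⟩⟩ ⟨⟨v', hv'⟩, ⟨T', hT', hTv'⟩⟩ h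
      obtain rfl : T = T' := congrArg Subtype.val h
      have h1 := hv.cells_eq_erase (T.symm (Fin.last n)).2 hTv
      have h2 := hv'.cells_eq_erase (T.symm (Fin.last n)).2 hTv'
      have h3 : diagram v = diagram v' := YoungDiagram.ext (h1.trans h2.symm)
      obtain rfl : v = v' := partition_ext fun i => by rw [h3]
      rfl
    · rintro ⟨T, hT⟩
      obtain ⟨v, hv, hv'⟩ := hT.exists_isHorizontalStrip
      exact ⟨⟨⟨v, hv⟩, ⟨T, hT, hv'⟩⟩, rfl⟩
  rw [numSYT, ← Nat.card_congr (Equiv.ofBijective F hF), Nat.card_sigma,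
    ← Finset.sum_subtype (Finset.univ.filter fun v => IsHorizontalStrip v p) (by simp)
      (fun v => Nat.card {T : Filling (n + 1) (diagram p) // T.IsStandard ∧
        (T.symm (Fin.last n)).1 ∉ (diagram v).cells})]
  refine Finset.sum_congr rfl fun v hv => ?_
  have hv' : IsHorizontalStrip v p := by simpa using hv
  have hlt : (diagram v).cells.card < (diagram p).cells.card := by
    have h1 := card_diagram v
    have h2 := card_diagram p
    change (diagram v).card < (diagram p).card
    omega
  obtain ⟨c, hc, hc'⟩ := Finset.exists_mem_notMem_of_card_lt_card hlt
  have her := hv'.cells_eq_erase hc hc'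
  rw [numSYT, ← Nat.card_congr (removeLastEquiv hc her)]
  refine Nat.card_congr (Equiv.subtypeEquivRight fun T => and_congr_right fun _ => ?_)
  rw [her, Finset.mem_erase, not_and_or, not_not]
  exact or_iff_left (not_not.2 (T.symm (Fin.last n)).2)

open scoped Classical in
/-- The branching rule for the degrees of the irreducible characters. -/
theorem irrChar_one_succ {n : ℕ} (p : (n + 1).Partition) :
    irrChar p 1 = ∑ v : n.Partition with IsHorizontalStrip v p, irrChar v 1 := by
  have h := sum_irrChar_youngEmbedding (rfl : n + 1 = n + 1) p 1
  rw [Fintype.sum_unique] at h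
  have h1 : youngEmbedding (rfl : n + 1 = n + 1) (1, default) = 1 := by
    rw [Subsingleton.elim (default : Equiv.Perm (Fin 1)) 1]
    exact map_one _
  rw [h1] at h
  simpa using h

theorem deg_irrChar {n : ℕ} (p : n.Partition) : deg (irrChar p) = numSYT p := by
  classical
  unfold deg
  induction n with
  | zero =>
    rw [Subsingleton.elim p (Nat.Partition.indiscrete 0), irrChar_indiscrete]
    have hempty : IsEmpty {c : ℕ × ℕ // c ∈ (diagram (Nat.Partition.indiscrete 0)).cells} := by
      rw [← Fintype.card_eq_zero_iff, Fintype.card_coe]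
      exact card_diagram _
    have : Nat.card {T : Filling 0 (diagram (Nat.Partition.indiscrete 0)) // T.IsStandard} = 1 := by
      rw [Nat.card_eq_one_iff_unique]
      refine ⟨⟨fun S T => Subtype.ext (Equiv.ext fun c => hempty.elim c)⟩,
        ⟨⟨Equiv.equivOfIsEmpty _ _, fun c => hempty.elim c, fun c => hempty.elim c⟩⟩⟩
    rw [numSYT, this]
    simp
  | succ n ih =>
    rw [irrChar_one_succ, numSYT_succ, Nat.cast_sum]
    exact Finset.sum_congr rfl fun v _ => ih v

/-! ### Inner products of the characters in the hook identity -/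

theorem sum_hookChar_mul_irrChar (k l : ℕ) {n : ℕ} (p : n.Partition) :
    ∑ x, hookChar k l n x * irrChar p x =
      if (diagram p).rowLen k ≤ l then (n.factorial : ℂ) else 0 := by
  simp only [hookChar, Finset.sum_apply, Finset.sum_mul]
  rw [Finset.sum_comm]
  simp only [sum_irrChar_mul_irrChar]
  rw [Finset.sum_ite_eq']
  simp [hook]

theorem isClassFunction_hookChar (k l n : ℕ) : IsClassFunction (hookChar k l n) :=
  IsClassFunction.sum _ fun p _ => isClassFunction_irrChar p

theorem deg_hookChar (k l n : ℕ) : deg (hookChar k l n) = hookSum k l n := by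
  rw [hookSum, Nat.cast_sum, deg, hookChar, Finset.sum_apply]
  exact Finset.sum_congr rfl fun p _ => deg_irrChar p

open scoped Classical in
theorem sum_irrCharSeq_mul_irrChar {n : ℕ} (w : List ℕ) (p : n.Partition) :
    ∑ x, irrCharSeq n w x * irrChar p x =
      if (w.SortedGE ∧ (w : Multiset ℕ).sum = n) ∧ ∀ i, (diagram p).rowLen i = w.getD i 0
        then (n.factorial : ℂ) else 0 := by
  unfold irrCharSeq
  by_cases h : w.SortedGE ∧ (w : Multiset ℕ).sum = n
  · rw [dif_pos h, sum_irrChar_mul_irrChar]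
    refine if_congr ?_ rfl rfl
    rw [and_iff_right h]
    constructor
    · rintro rfl i
      exact rowLen_diagram_ofSums h.1 h.2 i
    · intro h'
      exact partition_ext fun i => (rowLen_diagram_ofSums h.1 h.2 i).trans (h' i).symm
  · rw [dif_neg h, if_neg fun h' => h h'.1]
    simp

/-- A partition with parts at most `1` is determined by its size. -/
theorem eq_ite_of_antitone_of_le_one {f : ℕ → ℕ} (hf : Antitone f) (h1 : ∀ i, f i ≤ 1) {N s : ℕ}
    (hN : f N = 0) (hs : ∑ i ∈ Finset.range N, f i = s) (i : ℕ) :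
    f i = if i < s then 1 else 0 := by
  split_ifs with h
  · by_contra h0
    have hi : f i = 0 := by have := h1 i; omega
    have h2 : ∑ j ∈ Finset.range N, f j ≤ ∑ j ∈ Finset.range N, if j < i then 1 else 0 := by
      refine Finset.sum_le_sum fun j _ => ?_
      split_ifs with hj
      · exact h1 j
      · have := hf (not_lt.1 hj); omega
    rw [← Finset.sum_filter, Finset.sum_const, smul_eq_mul, mul_one] at h2
    have h3 : (Finset.filter (fun j => j < i) (Finset.range N)).card ≤ i := by
      conv_rhs => rw [← Finset.card_range i]
      exact Finset.card_le_card fun j hj => by simpa using (Finset.mem_filter.1 hj).2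
    omega
  · by_contra h0
    have hi : i < N := by
      by_contra h2
      have := hf (not_lt.1 h2); omega
    have h2 : ∑ j ∈ Finset.range (i + 1), 1 ≤ ∑ j ∈ Finset.range N, f j := by
      refine le_trans (Finset.sum_le_sum (g := f) fun j hj => ?_)
        (Finset.sum_le_sum_of_subset fun j hj => ?_)
      · have := hf (Nat.lt_succ_iff.1 (Finset.mem_range.1 hj)); omega
      · rw [Finset.mem_range] at hj ⊢; omega
    simp only [Finset.sum_const, Finset.card_range, smul_eq_mul, mul_one] at h2
    omega

/-- The partitions of the form `(k, k, 1, …, 1)`, among them the empty partition. -/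
def IsMotzkin {n : ℕ} (p : n.Partition) : Prop :=
  (diagram p).rowLen 0 = (diagram p).rowLen 1 ∧ (diagram p).rowLen 2 ≤ 1

theorem getD_motzkinWord (k r i : ℕ) : (k :: k :: List.replicate r 1).getD i 0 =
    if i < 2 then k else if i - 2 < r then 1 else 0 := by
  rcases i with _ | _ | i
  · rfl
  · rfl
  · rw [if_neg (by omega), List.getD_cons_succ, List.getD_cons_succ,
      List.getD_eq_getElem?_getD, List.getElem?_replicate]
    by_cases h : i < r
    · rw [if_pos h, if_pos (by omega), Option.getD_some]
    · rw [if_neg h, if_neg (by omega), Option.getD_none]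

open scoped Classical in
/-- Each partition `(k, k, 1, …, 1)` of `n` occurs in the Motzkin-sums character exactly once. -/
theorem sum_motzkinChar_mul_irrChar {n : ℕ} (p : n.Partition) :
    ∑ x, motzkinChar n x * irrChar p x = if IsMotzkin p then (n.factorial : ℂ) else 0 := by
  simp only [motzkinChar, Finset.sum_apply, Finset.sum_mul]
  rw [Finset.sum_comm]
  simp only [sum_irrCharSeq_mul_irrChar, getD_motzkinWord]
  have hval : ∀ k r, (∀ i, (diagram p).rowLen i =
      if i < 2 then k else if i - 2 < r then 1 else 0) → IsMotzkin p ∧ k = (diagram p).rowLen 0 := by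
    intro k r h
    refine ⟨⟨?_, ?_⟩, ?_⟩
    · rw [h 0, h 1]; rfl
    · rw [h 2, if_neg (by omega)]; split_ifs <;> omega
    · rw [h 0]; rfl
  by_cases hp : IsMotzkin p
  · rw [if_pos hp, Finset.sum_eq_single ((diagram p).rowLen 0), if_pos]
    · obtain ⟨h01, h2⟩ := hp
      have hanti : Antitone (diagram p).rowLen := fun i j => (diagram p).rowLen_anti i j
      have hz : (diagram p).rowLen (n + 2) = 0 := rowLen_eq_zero p (by omega)
      have hsum := sum_range_rowLen p hz
      rw [Finset.sum_range_succ', Finset.sum_range_succ'] at hsum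
      have htail := eq_ite_of_antitone_of_le_one (f := fun i => (diagram p).rowLen (i + 2))
        (fun i j hij => hanti (by omega)) (fun i => (hanti (by omega)).trans h2) hz rfl
      set r := ∑ i ∈ Finset.range n, (diagram p).rowLen (i + 2) with hr
      have hr' : n - 2 * (diagram p).rowLen 0 = r := by
        have : ∑ i ∈ Finset.range n, (diagram p).rowLen (i + 1 + 1) = r := rfl
        simp only [zero_add] at hsum
        omega
      have hsum' : 2 * (diagram p).rowLen 0 + r = n := by
        have : ∑ i ∈ Finset.range n, (diagram p).rowLen (i + 1 + 1) = r := rfl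
        simp only [zero_add] at hsum
        omega
      rw [hr']
      refine ⟨⟨?_, ?_⟩, fun i => ?_⟩
      · rw [List.sortedGE_iff_pairwise, List.pairwise_cons, List.pairwise_cons]
        have h1 : ∀ b ∈ List.replicate r 1, b ≤ (diagram p).rowLen 0 := by
          intro b hb
          obtain ⟨hr0, rfl⟩ := List.mem_replicate.1 hb
          have h3 := htail 0
          rw [if_pos (by omega)] at h3
          have h4 := hanti (show 0 ≤ 0 + 2 by omega)
          omega
        refine ⟨fun b hb => ?_, h1, List.pairwise_replicate.2 (Or.inr le_rfl)⟩
        rcases List.mem_cons.1 hb with rfl | hb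
        · exact le_rfl
        · exact h1 b hb
      · rw [Multiset.sum_coe, List.sum_cons, List.sum_cons, List.sum_replicate, smul_eq_mul]
        omega
      · split_ifs with h3 h4
        · interval_cases i
          · rfl
          · exact h01.symm
        · have := htail (i - 2)
          rw [if_pos h4] at this
          rw [← this]; congr 1; omega
        · have := htail (i - 2)
          rw [if_neg h4] at this
          rw [← this]; congr 1; omega
    · intro k _ hk
      exact if_neg fun h => hk (hval _ _ h.2).2
    · intro h
      refine if_neg fun h' => h ?_
      have h5 := h'.1.2
      rw [Multiset.sum_coe, List.sum_cons, List.sum_cons] at h5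
      rw [Finset.mem_range]
      omega
  · rw [if_neg hp]
    exact Finset.sum_eq_zero fun k _ => if_neg fun h => hp (hval _ _ h.2).1

theorem sum_one_mul_irrChar {n : ℕ} (p : n.Partition) :
    ∑ x, (1 : Equiv.Perm (Fin n) → ℂ) x * irrChar p x =
      if p = Nat.Partition.indiscrete n then (n.factorial : ℂ) else 0 := by
  rw [← irrChar_indiscrete, sum_irrChar_mul_irrChar]
  simp only [eq_comm]

theorem rowLen_indiscrete (n i : ℕ) :
    (diagram (Nat.Partition.indiscrete n)).rowLen i = if i = 0 then n else 0 := by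
  refine (rowLen_diagram_ofSums (w := [n])
    (List.sortedGE_iff_pairwise.2 (List.pairwise_singleton _ _)) (by simp) i).trans ?_
  rcases i with _ | i <;> simp

theorem sum_rowLen_zero_one {n : ℕ} {p : n.Partition} (h : (diagram p).rowLen 2 = 0) :
    (diagram p).rowLen 0 + (diagram p).rowLen 1 = n := by
  have := sum_range_rowLen p h
  simpa [Finset.sum_range_succ] using this

/-- The sum of the characters of the partitions with at most two rows is the permutation character
on the subsets of size `⌊n / 2⌋`. -/
theorem hookChar_two_zero (n : ℕ) :
    hookChar 2 0 n = outerProduct (Nat.add_sub_cancel' (Nat.div_le_self n 2)) 1 1 := by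
  classical
  refine (isClassFunction_hookChar 2 0 n).ext (isClassFunction_outerProduct _ _ _) fun p => ?_
  rw [sum_hookChar_mul_irrChar, sum_outerProduct_one_mul_irrChar]
  simp only [sum_one_mul_irrChar]
  rw [Finset.sum_ite_eq']
  have hiff : Nat.Partition.indiscrete (n / 2) ∈
      Finset.univ.filter (fun v : (n / 2).Partition => IsHorizontalStrip v p) ↔
        (diagram p).rowLen 2 ≤ 0 := by
    rw [Finset.mem_filter, and_iff_right (Finset.mem_univ _)]
    simp only [IsHorizontalStrip, rowLen_indiscrete]
    constructor
    · intro h; exact (h 1).2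
    · intro h i
      have h1 := sum_rowLen_zero_one (Nat.le_zero.1 h)
      have h2 := (diagram p).rowLen_anti 0 1 (by omega)
      rcases i with _ | i
      · rw [if_pos rfl, zero_add]; omega
      · have := (diagram p).rowLen_anti 2 (i + 1 + 1) (by omega)
        rw [if_neg (by omega)]; omega
  simp only [hiff]
  have hm := factorial_cast_ne_zero (n / 2)
  split_ifs
  · field_simp
  · simp

theorem youngEmbedding_injective {m k n : ℕ} (h : m + k = n) :
    Function.Injective (youngEmbedding h) :=
  ((finSumFinEquiv.trans (finCongr h)).permCongrHom.injective).comp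
    Equiv.Perm.sumCongrHom_injective

theorem deg_outerProduct {m k n : ℕ} (h : m + k = n) (f : Equiv.Perm (Fin m) → ℂ)
    (g : Equiv.Perm (Fin k) → ℂ) :
    deg (outerProduct h f g) = deg f * deg g * n.choose m := by
  have h1 : ∀ s, youngEmbedding h s = 1 ↔ s = 1 := fun s =>
    (youngEmbedding_injective h).eq_iff' (map_one _)
  simp only [deg, outerProduct, mul_one, inv_mul_cancel, h1]
  subst h
  rw [Finset.sum_const, Finset.sum_ite_eq', if_pos (Finset.mem_univ _), Finset.card_univ,
    Fintype.card_perm, Fintype.card_fin, nsmul_eq_mul, Nat.cast_add_choose]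
  simp only [Prod.fst_one, Prod.snd_one]
  ring

/-! ### Counting horizontal strips over `(k, k, 1, …, 1)` -/

/-- The row lengths of the partition `(k, k, 1, …, 1)` with `t ≥ 2` rows. -/
def motzkinRow (k t i : ℕ) : ℕ := if i < 2 then k else if i < t then 1 else 0

open scoped Classical in
/-- Let the fourth row of `p` have length at most `1`. Then `p / (k, k, 1, …, 1)` is a horizontal
strip exactly if `k` is the length of the second row of `p` and either `p` has `t ≥ 3` rows and
`(k, k, 1, …, 1)` has `t` or `t - 1` rows, or `p` has at most two rows and there are no ones. -/
theorem sum_card_isHorizontalStrip_isMotzkin {n : ℕ} (p : n.Partition) :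
    ∑ j ∈ Finset.range (n + 1),
      Finset.card {v : j.Partition | IsHorizontalStrip v p ∧ IsMotzkin v} =
      if (diagram p).rowLen 3 ≤ 1 then if (diagram p).rowLen 2 ≤ 0 then 1 else 2 else 0 := by
  rw [← Finset.card_sigma]
  set A := (Finset.range (n + 1)).sigma fun j =>
    ({v : j.Partition | IsHorizontalStrip v p ∧ IsMotzkin v} : Finset j.Partition) with hA
  have hmemA : ∀ x : Σ j : ℕ, j.Partition,
      x ∈ A ↔ x.1 ≤ n ∧ IsHorizontalStrip x.2 p ∧ IsMotzkin x.2 := by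
    intro x
    simp [hA, Finset.mem_sigma]
  have hanti : Antitone (diagram p).rowLen := fun i j => (diagram p).rowLen_anti i j
  have hpos : ∀ {m : ℕ} (v : m.Partition) (i : ℕ),
      1 ≤ (diagram v).rowLen i ↔ i < (diagram v).colLen 0 := fun v i => by
    rw [← YoungDiagram.mem_iff_lt_colLen, YoungDiagram.mem_iff_lt_rowLen, Nat.succ_le_iff]
  by_cases h3 : (diagram p).rowLen 3 ≤ 1
  · rw [if_pos h3]
    set k := (diagram p).rowLen 1 with hk
    set t := (diagram p).colLen 0 with ht
    have htn : t ≤ n := by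
      by_contra h
      have h1 := (hpos p n).2 (by omega)
      rw [rowLen_eq_zero p le_rfl] at h1
      omega
    have hR : Function.Injective fun x : Σ j : ℕ, j.Partition => (diagram x.2).rowLen := by
      rintro ⟨i, u⟩ ⟨j, v⟩ h
      have h' : ∀ a, (diagram u).rowLen a = (diagram v).rowLen a := congrFun h
      have h1 := sum_range_rowLen u (rowLen_eq_zero u (le_max_left i j))
      have h2 := sum_range_rowLen v (rowLen_eq_zero v (le_max_right i j))
      simp only [h'] at h1
      obtain rfl : i = j := h1.symm.trans h2
      obtain rfl : u = v := partition_ext h'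
      rfl
    -- The row lengths of the strips are `(k, k, 1, …, 1)` with `t` or `t - 1` rows, but at least two.
    -- For `t ≤ 2` both give the same partition, which is empty if `k = 0`.
    have himage : A.image (fun x => (diagram x.2).rowLen) =
        ({max 2 (t - 1), max 2 t} : Finset ℕ).image (motzkinRow k) := by
      ext f
      simp only [Finset.mem_image, hmemA]
      constructor
      · rintro ⟨⟨j, v⟩, ⟨-, hs, hv1, hv2⟩, rfl⟩
        simp only [] at hs hv1 hv2
        refine ⟨max 2 ((diagram v).colLen 0), ?_, funext fun i => ?_⟩
        · have h1 : (diagram v).colLen 0 ≤ t := by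
            by_contra h
            have h4 := ((hpos v t).2 (by omega)).trans (hs t).1
            exact lt_irrefl _ ((hpos p t).1 h4)
          have h2 : t - 1 ≤ (diagram v).colLen 0 := by
            by_contra h
            have h4 := ((hpos p ((diagram v).colLen 0 + 1)).2 (by omega)).trans
              (hs ((diagram v).colLen 0)).2
            exact lt_irrefl _ ((hpos v _).1 h4)
          rw [Finset.mem_insert, Finset.mem_singleton]
          omega
        · have h1 : (diagram v).rowLen 0 = k := by
            have h4 := (hs 0).2
            have h5 := (hs 1).1
            rw [zero_add] at h4
            omega
          simp only [motzkinRow]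
          split_ifs with h4 h5
          · interval_cases i
            · exact h1.symm
            · rw [← hv1]; exact h1.symm
          · have h6 := (hpos v i).2 (by omega)
            have h7 := (diagram v).rowLen_anti 2 i (by omega)
            omega
          · have h6 := (hpos v i).not.2 (by omega)
            omega
      · rintro ⟨s, hs, rfl⟩
        rw [Finset.mem_insert, Finset.mem_singleton] at hs
        have hle : ∀ i, motzkinRow k s i ≤ (diagram p).rowLen i := by
          intro i
          simp only [motzkinRow]
          split_ifs with h4 h5
          · exact hanti (by omega)
          · exact (hpos p i).2 (by omega)
          · exact Nat.zero_le _
        have hge : ∀ i, (diagram p).rowLen (i + 1) ≤ motzkinRow k s i := by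
          intro i
          simp only [motzkinRow]
          split_ifs with h4 h5
          · exact hanti (by omega)
          · exact (hanti (by omega)).trans h3
          · have := (hpos p (i + 1)).not.2 (by omega)
            omega
        have hf : Antitone (motzkinRow k s) := by
          refine antitone_nat_of_succ_le fun i => ?_
          exact (hle (i + 1)).trans (hge i)
        have hz : motzkinRow k s (n + 2) = 0 := by
          simp only [motzkinRow]
          rw [if_neg (by omega), if_neg (by omega)]
        obtain ⟨v, hv⟩ := exists_partition (n + 2) hf hz rfl
        refine ⟨⟨_, v⟩, ⟨?_, fun i => ?_, ?_, ?_⟩, funext hv⟩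
        · exact (Finset.sum_le_sum fun i _ => hle i).trans
            (sum_range_rowLen p (rowLen_eq_zero p (by omega))).le
        · rw [hv]; exact ⟨hle i, hge i⟩
        · rw [hv, hv]; rfl
        · rw [hv]; simp only [motzkinRow]; split_ifs <;> omega
    rw [← Finset.card_image_of_injective A hR, himage, Finset.card_image_of_injOn]
    · by_cases h2 : (diagram p).rowLen 2 ≤ 0
      · have h4 := (hpos p 2).not.1 (by omega)
        rw [if_pos h2, max_eq_left (by omega), max_eq_left (by omega), Finset.pair_eq_singleton,
          Finset.card_singleton]
      · have h4 := (hpos p 2).1 (by omega)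
        rw [if_neg h2, Finset.card_pair (by omega)]
    · have hlt : ∀ a b, 2 ≤ a → a < b → motzkinRow k a ≠ motzkinRow k b := by
        intro a b ha hab h
        have h4 := congrFun h a
        simp only [motzkinRow] at h4
        rw [if_neg (by omega), if_neg (by omega), if_neg (by omega), if_pos hab] at h4
        omega
      have hge : ∀ a ∈ (({max 2 (t - 1), max 2 t} : Finset ℕ) : Set ℕ), 2 ≤ a := by
        intro a ha
        simp only [Finset.coe_insert, Finset.coe_singleton, Set.mem_insert_iff,
          Set.mem_singleton_iff] at ha
        omega
      intro a ha b hb h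
      rcases lt_trichotomy a b with h4 | h4 | h4
      · exact absurd h (hlt a b (hge a ha) h4)
      · exact h4
      · exact absurd h.symm (hlt b a (hge b hb) h4)
  · rw [if_neg h3, Finset.card_eq_zero, Finset.eq_empty_iff_forall_notMem]
    intro x hx
    have h1 := (hmemA x).1 hx
    exact h3 ((h1.2.1 2).2.trans h1.2.2.2)

theorem hookChar_three_one (n : ℕ) :
    hookChar 3 1 n = (1 / 2 : ℂ) • (hookChar 2 0 n + ∑ j : Fin (n + 1),
      outerProduct (Nat.add_sub_cancel' (Nat.le_of_lt_succ j.isLt)) (motzkinChar j)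
        (irrChar (Nat.Partition.indiscrete (n - j)))) := by
  classical
  refine (isClassFunction_hookChar 3 1 n).ext (IsClassFunction.smul (IsClassFunction.add
    (isClassFunction_hookChar 2 0 n)
    (IsClassFunction.sum _ fun j _ => isClassFunction_outerProduct _ _ _)) _) fun p => ?_
  have hterm : ∀ j : Fin (n + 1), ∑ x, outerProduct
      (Nat.add_sub_cancel' (Nat.le_of_lt_succ j.isLt)) (motzkinChar j)
        (irrChar (Nat.Partition.indiscrete (n - j))) x * irrChar p x =
      n.factorial * (Finset.card
        {v : (j : ℕ).Partition | IsHorizontalStrip v p ∧ IsMotzkin v} : ℂ) := by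
    intro j
    rw [irrChar_indiscrete, sum_outerProduct_one_mul_irrChar]
    simp only [sum_motzkinChar_mul_irrChar]
    rw [← Finset.sum_filter, Finset.filter_filter, Finset.sum_const, nsmul_eq_mul]
    have := factorial_cast_ne_zero j
    field_simp
  have hcount := congrArg (Nat.cast (R := ℂ)) (sum_card_isHorizontalStrip_isMotzkin p)
  rw [Nat.cast_sum, ← Fin.sum_univ_eq_sum_range (fun j => (Finset.card
        {v : j.Partition | IsHorizontalStrip v p ∧ IsMotzkin v} : ℂ))] at hcount
  simp only [Pi.smul_apply, Pi.add_apply, Finset.sum_apply, smul_eq_mul, mul_assoc,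
    ← Finset.mul_sum, add_mul, Finset.sum_add_distrib, Finset.sum_mul]
  rw [Finset.sum_comm]
  simp only [hterm, ← Finset.mul_sum, hcount, sum_hookChar_mul_irrChar]
  have h23 : (diagram p).rowLen 3 ≤ (diagram p).rowLen 2 := (diagram p).rowLen_anti 2 3 (by omega)
  split_ifs with h1 h2 h2
  · push_cast; ring
  · push_cast; ring
  · omega
  · simp

end HookChar


theorem proposition2p2 (n : ℕ) :
    HookChar.hookChar 3 1 n =
      (1 / 2 : ℂ) • (HookChar.hookChar 2 0 n +
        ∑ j : Fin (n + 1),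
          HookChar.outerProduct (Nat.add_sub_cancel' (Nat.le_of_lt_succ j.isLt))
            (HookChar.motzkinChar j)
            (HookChar.irrChar (Nat.Partition.indiscrete (n - j)))) ∧
    HookChar.deg (HookChar.hookChar 3 1 n) = (HookChar.hookSum 3 1 n : ℂ) ∧
    (HookChar.hookSum 3 1 n : ℂ) =
      1 / 2 * ((n.choose (n / 2) : ℂ) +
        ∑ j ∈ Finset.range (n + 1), HookChar.motzkinSum j * (n.choose j : ℂ)) := by
  have h := HookChar.hookChar_three_one n
  refine ⟨h, HookChar.deg_hookChar 3 1 n, ?_⟩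
  have h1 : ∀ m : ℕ, HookChar.deg (1 : Equiv.Perm (Fin m) → ℂ) = 1 := fun m => rfl
  have h2 : HookChar.deg (HookChar.hookChar 2 0 n) = n.choose (n / 2) := by
    rw [HookChar.hookChar_two_zero, HookChar.deg_outerProduct, h1, h1, one_mul, one_mul]
  rw [← HookChar.deg_hookChar, h, ← h2,
    ← Fin.sum_univ_eq_sum_range (fun j => HookChar.motzkinSum j * (n.choose j : ℂ))]
  have h3 : ∀ j : Fin (n + 1), HookChar.motzkinSum j * (n.choose j : ℂ) =
      HookChar.deg (HookChar.outerProduct (Nat.add_sub_cancel' (Nat.le_of_lt_succ j.isLt))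
            (HookChar.motzkinChar j)
            (HookChar.irrChar (Nat.Partition.indiscrete (n - j)))) := by
    intro j
    rw [HookChar.deg_outerProduct, HookChar.irrChar_indiscrete, h1, mul_one]
    rfl
  simp only [h3, HookChar.deg, Pi.smul_apply, Pi.add_apply, Finset.sum_apply, smul_eq_mul]
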